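/- **Setting.** Let $g>0$, $\sigma>0$, let $J=[\![\gamma]\!]\in\mathbb R$ with $|J|\le\sigma$, and let $\theta_1,\theta_2\ge 0$ with $\theta_1+\theta_2<\pi$. The vessel is the sector with vertex at the origin whose left and right walls are the rays at the polar angles $\pi-\theta_1$ and $\theta_2$. Let $\gamma=\arcsin(-J/\sigma)$, $\psi_1=\gamma+\frac\pi2-\theta_1$ and $\psi_2=-\gamma-\frac\pi2+\theta_2$, and assume that $\psi_1$ and $\psi_2$ have the same sign, that is, $\psi_1\psi_2>0$. A *free surface* is a curve $(x(s),y(s))$, parametrized by arc length on $[0,L]$ with $L>0$, with slope angle $\psi(s)\in(-\pi,\pi)$, which starts on the left wall with slope angle $\psi_1$, ends on the right wall with slope angle $\psi_2$ (both contact points are different from the vertex), and satisfies for some constant $P_0\in\mathbb R$ the Euler–Lagrange system $$x'=\cos\psi,\qquad y'=\sin\psi,\qquad \sigma\psi'=gy-P_0 .$$ Its volume $\mathscr V$ is the area of the region enclosed by the curve and the two walls (the union of the segments joining the vertex to the curve). When $\psi_1,\psi_2<0$, say that the surface is of *interior type* if the maximum of $\psi$ is attained at an interior point and is strictly larger than $\max(\psi_1,\psi_2)$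 (and negative), and of *boundary type* if the maximum of $\psi$ is attained at a contact point. When $\psi_1,\psi_2>0$ (the mirror image), use the minimum of $\psi$ and $\min(\psi_1,\psi_2)$ instead. In both situations the extremum in question is the point where $|\psi|$ is smallest. Let $V_1$ be the supremum of the volumes of the free surfaces of boundary type ($V_1=0$ if there are none, which happens for $\psi_1=\psi_2$) and $V_m$ the infimum of the volumes of the free surfaces of interior type. **Theorem.** In this same-sign case: 1. $V_m\le V_1<\infty$, and $V_m>0$ if $\psi_1\ne\psi_2$. 2. For every prescribed volume $V>0$ there is at least one free surface with volume $V$. More precisely: - if $V>V_m$, there is one of interior type; - if $V=V_m$, there is one on which $gy=P_0$ at a point where $|\psi|$ is smallest (possibly a contact point); - if $0<V\le V_1$, there is one of boundary type. 3. If $V_1>V_m$, the solution is not unique: for every $V\in[V_m,V_1]$ there are two different free surfaces (different as sets of points) with volume $V$. 4. Every free surface is a polar graph $\{(\rho(\theta)\cos\theta,\rho(\theta)\sin\theta):\theta_2\le\theta\le\pi-\theta_1\}$ with $\rho>0$ of class $C^2$ up to the ends, its volume is $\mathcal V(\rho)=\frac12\int_{\theta_2}^{\pi-\theta_1}\rho^2\,d\theta$,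 and, with the same $P_0$, $$g\rho^2\sin\theta+\frac{\sigma\rho}{\sqrt{\rho^2+\rho'^2}}-\sigma\,\partial_\theta\Big(\frac{\rho'}{\sqrt{\rho^2+\rho'^2}}\Big)-P_0\,\rho=0,\qquad \frac{\rho'}{\sqrt{\rho^2+\rho'^2}}(\theta_2)=-\frac J\sigma,\qquad \frac{\rho'}{\sqrt{\rho^2+\rho'^2}}(\pi-\theta_1)=\frac J\sigma .$$ 5. If $|\psi_1|,|\psi_2|\le\frac\pi2$ (in particular whenever $\theta_1,\theta_2\le\frac\pi2$), every free surface is the graph of a continuous function $v$ on an interval $[x_1,x_2]$, $x_1<x_2$, of class $C^2$ on $(x_1,x_2)$, that solves, with the same $P_0$, $$\sigma\,\partial_x\Big(\frac{v_x}{\sqrt{1+v_x^2}}\Big)=gv-P_0\ \text{ on }(x_1,x_2),\qquad \frac{v_x}{\sqrt{1+v_x^2}}(x_1)=\sin\psi_1,\qquad \frac{v_x}{\sqrt{1+v_x^2}}(x_2)=\sin\psi_2,$$ the boundary values being understood as one-sided limits. -/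

import Mathlib

open Real Set Filter Topology MeasureTheory

namespace Capillary

/-- The angle `γ ∈ [-π/2, π/2]` determined by `sin γ = -⟦γ⟧/σ`; the energy jump `⟦γ⟧` is `J`. -/
noncomputable def gammaAngle (σ J : ℝ) : ℝ := arcsin (-J / σ)

/-- The prescribed slope angle `ψ₁ = γ + π/2 - θ₁` at the left wall. -/
noncomputable def psiLeft (σ J θ₁ : ℝ) : ℝ := gammaAngle σ J + π / 2 - θ₁

/-- The prescribed slope angle `ψ₂ = -γ - π/2 + θ₂` at the right wall. -/
noncomputable def psiRight (σ J θ₂ : ℝ) : ℝ := -gammaAngle σ J - π / 2 + θ₂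

/-- A free surface solving the Euler-Lagrange system with multiplier `P₀`, as a curve
parametrized by arc length `s ∈ [0, L]` from the left wall to the right wall, the walls being the
rays from the origin at the polar angles `π - θ₁` and `θ₂`. The function `ψ` is the slope angle in
the direction of travel, and `ψ' = (g y - P₀) / σ` says that the curvature is `(g y - P₀) / σ`;
where `cos ψ > 0`, the curve is a graph `y = v(x)` and the equation reads
`σ (v' / √(1 + v'²))' = g v - P₀`. -/
structure FreeSurface (g σ J θ₁ θ₂ : ℝ) where
  L : ℝ
  P₀ : ℝ
  x : ℝ → ℝ
  y : ℝ → ℝ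
  ψ : ℝ → ℝ
  L_pos : 0 < L
  x_deriv : ∀ s ∈ Icc 0 L, HasDerivWithinAt x (cos (ψ s)) (Icc 0 L) s
  y_deriv : ∀ s ∈ Icc 0 L, HasDerivWithinAt y (sin (ψ s)) (Icc 0 L) s
  ψ_deriv : ∀ s ∈ Icc 0 L, HasDerivWithinAt ψ ((g * y s - P₀) / σ) (Icc 0 L) s
  /-- slope angles are principal values -/
  ψ_range : ∀ s ∈ Icc 0 L, ψ s ∈ Ioo (-π) π
  left_contact : ∃ r : ℝ, 0 < r ∧ x 0 = r * cos (π - θ₁) ∧ y 0 = r * sin (π - θ₁)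
  right_contact : ∃ r : ℝ, 0 < r ∧ x L = r * cos θ₂ ∧ y L = r * sin θ₂
  left_angle : ψ 0 = psiLeft σ J θ₁
  right_angle : ψ L = psiRight σ J θ₂

namespace FreeSurface

variable {g σ J θ₁ θ₂ : ℝ}

/-- The set of points of the free surface. -/
def trace (S : FreeSurface g σ J θ₁ θ₂) : Set (ℝ × ℝ) :=
  (fun s => (S.x s, S.y s)) '' Icc 0 S.L

/-- The region enclosed by the free surface and the two walls: it is made of the segments that
join the vertex of the vessel (the origin) to the points of the surface. -/
def region (S : FreeSurface g σ J θ₁ θ₂) : Set (ℝ × ℝ) :=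
  {p | ∃ s ∈ Icc 0 S.L, ∃ t ∈ Icc (0 : ℝ) 1, p = (t * S.x s, t * S.y s)}

/-- The volume of the fluid: the area (Lebesgue measure) of the enclosed region. -/
noncomputable def vol (S : FreeSurface g σ J θ₁ θ₂) : ENNReal := volume S.region

/-- The slope angle has its extreme value `ψₘ` in the interior, with `ψₘ` strictly between
`max ψ₁ ψ₂` and `0` when `ψ₁, ψ₂ < 0` (then `ψₘ` is the maximum of `ψ`), and strictly between
`0` and `min ψ₁ ψ₂` in the mirror-image situation `ψ₁, ψ₂ > 0` (then `ψₘ` is the minimum of `ψ`).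
In both situations `ψₘ` is where the steepness `|ψ|` is smallest. -/
def InteriorPeak (S : FreeSurface g σ J θ₁ θ₂) : Prop :=
  ∃ s ∈ Ioo 0 S.L, |S.ψ s| < |S.ψ 0| ∧ |S.ψ s| < |S.ψ S.L| ∧
    IsMinOn (fun t => |S.ψ t|) (Icc 0 S.L) s

/-- The extreme value of the slope angle is attained at one of the two contact points:
the maximum of `ψ` when `ψ₁, ψ₂ < 0`, the minimum when `ψ₁, ψ₂ > 0`. -/
def BoundaryPeak (S : FreeSurface g σ J θ₁ θ₂) : Prop :=
  IsMinOn (fun t => |S.ψ t|) (Icc 0 S.L) 0 ∨ IsMinOn (fun t => |S.ψ t|) (Icc 0 S.L) S.L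

end FreeSurface

/-- `V₁`: the supremum of the volumes of the free surfaces whose slope angle has its extreme value
at a contact point. It is `0` when there are none, which happens for `ψ₁ = ψ₂`, where these
surfaces degenerate to a point. -/
noncomputable def V1 (g σ J θ₁ θ₂ : ℝ) : ENNReal :=
  ⨆ (S : FreeSurface g σ J θ₁ θ₂) (_ : S.BoundaryPeak), S.vol

/-- `Vₘ`: the infimum of the volumes of the free surfaces whose slope angle has its extreme value
in the interior. -/
noncomputable def Vm (g σ J θ₁ θ₂ : ℝ) : ENNReal :=
  ⨅ (S : FreeSurface g σ J θ₁ θ₂) (_ : S.InteriorPeak), S.vol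

/-- The Euler-Lagrange system in Cartesian coordinates, for `v` on `[a, b]`:
`σ (v' / √(1 + v'²))' = g v - P₀` in the interior, and `v' / √(1 + v'²)` takes the boundary values
`sin ψ₁` at `a` and `sin ψ₂` at `b` (as one-sided limits, so that a vertical contact
`ψᵢ = ± π / 2` is covered). -/
def CartesianSystem (g σ ψ₁ ψ₂ P₀ a b : ℝ) (v : ℝ → ℝ) : Prop :=
  a < b ∧ ContinuousOn v (Icc a b) ∧ ContDiffOn ℝ 2 v (Ioo a b) ∧
  (∀ x ∈ Ioo a b,
    σ * deriv (fun t => deriv v t / √(1 + deriv v t ^ 2)) x = g * v x - P₀) ∧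
  Tendsto (fun t => deriv v t / √(1 + deriv v t ^ 2)) (𝓝[>] a) (𝓝 (sin ψ₁)) ∧
  Tendsto (fun t => deriv v t / √(1 + deriv v t ^ 2)) (𝓝[<] b) (𝓝 (sin ψ₂))

/-- The angular interval of the vessel. -/
def angles (θ₁ θ₂ : ℝ) : Set ℝ := Icc θ₂ (π - θ₁)

/-- `ρ' / √(ρ² + ρ'²)`, with one-sided derivatives at the ends of the angular interval. -/
noncomputable def polarFlux (θ₁ θ₂ : ℝ) (ρ : ℝ → ℝ) (θ : ℝ) : ℝ :=
  derivWithin ρ (angles θ₁ θ₂) θ / √(ρ θ ^ 2 + derivWithin ρ (angles θ₁ θ₂) θ ^ 2)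

/-- The Euler-Lagrange system in polar coordinates, with the natural boundary conditions of the
energy `(g/3) ∫ ρ³ sin θ + σ ∫ √(ρ² + ρ'²) - J (ρ(π - θ₁) + ρ(θ₂))` on `θ₂ ≤ θ ≤ π - θ₁` under the
constraint that `(1/2) ∫ ρ²` is prescribed. -/
def PolarSystem (g σ J θ₁ θ₂ P₀ : ℝ) (ρ : ℝ → ℝ) : Prop :=
  (∀ θ ∈ angles θ₁ θ₂, 0 < ρ θ) ∧ ContDiffOn ℝ 2 ρ (angles θ₁ θ₂) ∧
  (∀ θ ∈ angles θ₁ θ₂,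
    g * ρ θ ^ 2 * sin θ + σ * (ρ θ / √(ρ θ ^ 2 + derivWithin ρ (angles θ₁ θ₂) θ ^ 2))
      - σ * derivWithin (polarFlux θ₁ θ₂ ρ) (angles θ₁ θ₂) θ - P₀ * ρ θ = 0) ∧
  polarFlux θ₁ θ₂ ρ θ₂ = -(J / σ) ∧ polarFlux θ₁ θ₂ ρ (π - θ₁) = J / σ

/-- The volume functional `(1/2) ∫ ρ² dθ` over the angular interval. -/
noncomputable def polarVolume (θ₁ θ₂ : ℝ) (ρ : ℝ → ℝ) : ℝ :=
  (1 / 2) * ∫ θ in θ₂..(π - θ₁), ρ θ ^ 2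

end Capillary

/-! The reflection `x ↦ -x` exchanges the two signs, so let `ψ₁, ψ₂ < 0`. Differentiating the third
equation gives the pendulum equation `ψ'' = (g/σ) sin ψ`, with a conserved energy. The energy and
uniqueness at the equilibrium `ψ = 0` keep `ψ` negative (`ψ_neg`). Hence height and curvature
strictly decrease along the curve, and `ψ` has at most one peak.

Graphs: the point where the tangent line meets the horizontal axis moves monotonically on each side
of the peak of `ψ`. The contact angles put it on the positive side at both ends, so the support
function is positive (`support_pos_of_neg`). The curve is therefore seen from the vertex with
strictly decreasing polar angle, which yields the polar graph, its equation and the area `(1/2) ∫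
support`.

One parameter: let `h` be the height difference of the contact points, `κ = g/σ`, `k = κh²/2`, and
let `τ ∈ [0, 1]` be the depth below the left contact divided by `h`. The energy identity makes `cos
ψ` an explicit quadratic in `τ` that depends only on `k` and the end angles. Integrating `cot ψ`
over the depth gives the horizontal extent `h · profileInt`, and the wall conditions then fix both
contact points. So the height difference determines the volume (`dropVolume`). Surfaces exist
exactly while the quadratic stays below `1`, that is for `0 < h < hₘ` (`param_mem`,
`exists_freeSurface`). The peak is interior exactly when `k > |cos ψ₂ - cos ψ₁|`, that is for `h >
h₀`.

The volume `V(h)` is continuous with `V(0) = 0`, and it tends to infinity at `hₘ`, because there the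
profile becomes horizontal at an inner depth and its length diverges logarithmically
(`tendsto_profileInt`). Thus `Vₘ` is the minimum of `V` on `[h₀, hₘ)` and `V₁` its maximum on `[0,
h₀]`; the common point `h₀` gives `Vₘ ≤ V₁`, and the intermediate value theorem on the two intervals
gives existence and non-uniqueness (`HasVolumeCurve.volume_dichotomy`). -/

namespace Capillary

/-! ### Monotonicity, inverse functions and smoothness on a closed interval. -/

section Calculus

variable {f f' : ℝ → ℝ} {a b : ℝ}

theorem monotoneOn_Icc_of_hasDerivWithinAt
    (hf : ∀ x ∈ Icc a b, HasDerivWithinAt f (f' x) (Icc a b) x)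
    (hf' : ∀ x ∈ Icc a b, 0 ≤ f' x) : MonotoneOn f (Icc a b) := by
  refine monotoneOn_of_hasDerivWithinAt_nonneg (convex_Icc a b) (f' := f')
    (fun x hx => (hf x hx).continuousWithinAt) ?_ ?_
  · intro x hx
    exact (hf x (interior_subset hx)).mono interior_subset
  · exact fun x hx => hf' x (interior_subset hx)

theorem strictMonoOn_Icc_of_hasDerivWithinAt
    (hf : ∀ x ∈ Icc a b, HasDerivWithinAt f (f' x) (Icc a b) x)
    (hf' : ∀ x ∈ Ioo a b, 0 < f' x) : StrictMonoOn f (Icc a b) := by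
  refine strictMonoOn_of_hasDerivWithinAt_pos (convex_Icc a b) (f' := f')
    (fun x hx => (hf x hx).continuousWithinAt) ?_ ?_
  · intro x hx
    exact (hf x (interior_subset hx)).mono interior_subset
  · rw [interior_Icc]; exact hf'

theorem antitoneOn_Icc_of_hasDerivWithinAt
    (hf : ∀ x ∈ Icc a b, HasDerivWithinAt f (f' x) (Icc a b) x)
    (hf' : ∀ x ∈ Icc a b, f' x ≤ 0) : AntitoneOn f (Icc a b) := by
  have := monotoneOn_Icc_of_hasDerivWithinAt (f := fun x => -f x) (f' := fun x => -f' x)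
    (fun x hx => (hf x hx).neg) (fun x hx => by linarith [hf' x hx])
  intro x hx y hy hxy
  simpa using this hx hy hxy

theorem strictAntiOn_Icc_of_hasDerivWithinAt
    (hf : ∀ x ∈ Icc a b, HasDerivWithinAt f (f' x) (Icc a b) x)
    (hf' : ∀ x ∈ Ioo a b, f' x < 0) : StrictAntiOn f (Icc a b) := by
  have := strictMonoOn_Icc_of_hasDerivWithinAt (f := fun x => -f x) (f' := fun x => -f' x)
    (fun x hx => (hf x hx).neg) (fun x hx => by linarith [hf' x hx])
  intro x hx y hy hxy
  simpa using this hx hy hxy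

theorem eq_left_of_hasDerivWithinAt_zero
    (hf : ∀ x ∈ Icc a b, HasDerivWithinAt f 0 (Icc a b) x) {x : ℝ} (hx : x ∈ Icc a b) :
    f x = f a := by
  have hab : a ≤ b := hx.1.trans hx.2
  have h1 := monotoneOn_Icc_of_hasDerivWithinAt hf (fun _ _ => le_rfl)
    (left_mem_Icc.2 hab) hx hx.1
  have h2 := antitoneOn_Icc_of_hasDerivWithinAt hf (fun _ _ => le_rfl)
    (left_mem_Icc.2 hab) hx hx.1
  linarith

/-- The derivative may vanish at the two ends, where the inverse is only claimed to be continuous.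
This covers a vertical contact, at which `x' = cos ψ = 0`. -/
theorem exists_inverse_Icc (hab : a ≤ b)
    (hf : ∀ x ∈ Icc a b, HasDerivWithinAt f (f' x) (Icc a b) x)
    (hf' : ∀ x ∈ Ioo a b, 0 < f' x) :
    ∃ k : ℝ → ℝ, MapsTo k (Icc (f a) (f b)) (Icc a b) ∧ (∀ y ∈ Icc (f a) (f b), f (k y) = y) ∧
      (∀ x ∈ Icc a b, k (f x) = x) ∧ ContinuousOn k (Icc (f a) (f b)) ∧
      ∀ y ∈ Icc (f a) (f b), f' (k y) ≠ 0 →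
        HasDerivWithinAt k (f' (k y))⁻¹ (Icc (f a) (f b)) y := by
  have hmono := strictMonoOn_Icc_of_hasDerivWithinAt hf hf'
  have hcont : ContinuousOn f (Icc a b) := fun x hx => (hf x hx).continuousWithinAt
  have himg : f '' Icc a b = Icc (f a) (f b) := by
    refine Subset.antisymm ?_ (intermediate_value_Icc hab hcont)
    rintro _ ⟨x, hx, rfl⟩
    exact ⟨hmono.monotoneOn (left_mem_Icc.2 hab) hx hx.1,
      hmono.monotoneOn hx (right_mem_Icc.2 hab) hx.2⟩
  set k := Function.invFunOn f (Icc a b) with hk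
  have hmaps : MapsTo k (Icc (f a) (f b)) (Icc a b) := by
    intro y hy
    rw [← himg] at hy
    exact Function.invFunOn_mem hy
  have hright : ∀ y ∈ Icc (f a) (f b), f (k y) = y := by
    intro y hy
    rw [← himg] at hy
    exact Function.invFunOn_eq hy
  have hleft : ∀ x ∈ Icc a b, k (f x) = x := fun x hx => hmono.injOn.leftInvOn_invFunOn hx
  have hkc : ContinuousOn k (Icc (f a) (f b)) := by
    -- A continuous bijection from a compact interval has a continuous inverse: preimages of closed
    -- sets under `k` are images of compact sets under `f`.
    refine continuousOn_iff_isClosed.2 fun t ht => ⟨f '' (t ∩ Icc a b), ?_, ?_⟩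
    · exact ((isCompact_Icc.inter_left ht).image_of_continuousOn
        (hcont.mono inter_subset_right)).isClosed
    · ext y
      constructor
      · rintro ⟨h1, h2⟩
        exact ⟨⟨k y, ⟨h1, hmaps h2⟩, hright y h2⟩, h2⟩
      · rintro ⟨⟨x, ⟨h1, h2⟩, rfl⟩, h3⟩
        exact ⟨by simpa [hleft x h2] using h1, h3⟩
  refine ⟨k, hmaps, hright, hleft, hkc, fun y hy h0 => ?_⟩
  have he : ((ContinuousLinearEquiv.unitsEquivAut ℝ (Units.mk0 _ h0) : ℝ ≃L[ℝ] ℝ) : ℝ →L[ℝ] ℝ) =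
      ContinuousLinearMap.toSpanSingleton ℝ (f' (k y)) := by
    ext; simp
  have h2 := (hf (k y) (hmaps hy)).hasFDerivWithinAt
  rw [← he] at h2
  have h3 := (HasFDerivWithinAt.of_local_left_inverse
    (tendsto_nhdsWithin_iff.2 ⟨hkc y hy, eventually_nhdsWithin_of_forall hmaps⟩)
    h2 hy (eventually_nhdsWithin_of_forall hright)).hasDerivWithinAt
  have h4 : (ContinuousLinearEquiv.unitsEquivAut ℝ (Units.mk0 _ h0)).symm 1 = (f' (k y))⁻¹ := by
    rw [ContinuousLinearEquiv.symm_apply_eq]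
    simp [h0]
  rw [← h4]
  exact h3

theorem contDiffOn_two_of_hasDerivWithinAt {f'' : ℝ → ℝ} {t : Set ℝ} (hu : UniqueDiffOn ℝ t)
    (hf : ∀ x ∈ t, HasDerivWithinAt f (f' x) t x)
    (hf' : ∀ x ∈ t, HasDerivWithinAt f' (f'' x) t x)
    (hf'' : ContinuousOn f'' t) : ContDiffOn ℝ 2 f t := by
  have step : ∀ {n : ℕ} {u u' : ℝ → ℝ},
      (∀ x ∈ t, HasDerivWithinAt u (u' x) t x) → ContDiffOn ℝ n u' t →
      ContDiffOn ℝ (n + 1) u t := by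
    intro n u u' h1 h2
    rw [contDiffOn_succ_iff_derivWithin hu]
    refine ⟨fun x hx => (h1 x hx).differentiableWithinAt, by simp, h2.congr fun x hx => ?_⟩
    exact (h1 x hx).derivWithin (hu x hx)
  have h1 : ContDiffOn ℝ ((0 : ℕ) + 1) f' t :=
    step hf' (by simpa [contDiffOn_zero] using hf'')
  have h2 : ContDiffOn ℝ ((1 : ℕ) + 1) f t := step hf (by simpa using h1)
  simpa [one_add_one_eq_two] using h2

end Calculus

end Capillary

/-! ### Reflection, the pendulum equation, and positivity of the support function. -/

namespace Capillary

theorem hasDerivWithinAt_comp_sub_left_Icc {f : ℝ → ℝ} {f' L s : ℝ}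
    (hf : HasDerivWithinAt f f' (Icc 0 L) (L - s)) :
    HasDerivWithinAt (fun t => f (L - t)) (-f') (Icc 0 L) s := by
  have h1 : HasDerivWithinAt (fun t : ℝ => L - t) (-1) (Icc 0 L) s := by
    simpa using (hasDerivWithinAt_id s (Icc 0 L)).const_sub L
  have h2 := HasDerivWithinAt.comp s hf h1 (fun t ht => ⟨by linarith [ht.2], by linarith [ht.1]⟩)
  simpa [Function.comp_def] using h2

theorem psiLeft_swap (σ J θ₂ : ℝ) : psiLeft σ J θ₂ = -psiRight σ J θ₂ := by
  unfold psiLeft psiRight; ring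

theorem psiRight_swap (σ J θ₁ : ℝ) : psiRight σ J θ₁ = -psiLeft σ J θ₁ := by
  unfold psiLeft psiRight; ring

namespace FreeSurface

variable {g σ J θ₁ θ₂ : ℝ} (S : FreeSurface g σ J θ₁ θ₂)

/-- The image of a free surface under the reflection `x ↦ -x`. -/
noncomputable def mirror : FreeSurface g σ J θ₂ θ₁ where
  L := S.L
  P₀ := S.P₀
  x s := -S.x (S.L - s)
  y s := S.y (S.L - s)
  ψ s := -S.ψ (S.L - s)
  L_pos := S.L_pos
  x_deriv s hs := by
    have := (hasDerivWithinAt_comp_sub_left_Icc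
      (S.x_deriv (S.L - s) ⟨by linarith [hs.2], by linarith [hs.1]⟩)).neg
    exact this.congr_deriv (by simp)
  y_deriv s hs := by
    have := (hasDerivWithinAt_comp_sub_left_Icc
      (S.y_deriv (S.L - s) ⟨by linarith [hs.2], by linarith [hs.1]⟩))
    simpa using this
  ψ_deriv s hs := by
    have := (hasDerivWithinAt_comp_sub_left_Icc
      (S.ψ_deriv (S.L - s) ⟨by linarith [hs.2], by linarith [hs.1]⟩)).neg
    exact this.congr_deriv (by simp)
  ψ_range s hs := by
    have := S.ψ_range (S.L - s) ⟨by linarith [hs.2], by linarith [hs.1]⟩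
    exact ⟨by linarith [this.2], by linarith [this.1]⟩
  left_contact := by
    obtain ⟨r, hr, hx, hy⟩ := S.right_contact
    exact ⟨r, hr, by simp [hx, cos_pi_sub], by simp [hy, sin_pi_sub]⟩
  right_contact := by
    obtain ⟨r, hr, hx, hy⟩ := S.left_contact
    exact ⟨r, hr, by simp [hx, cos_pi_sub], by simp [hy, sin_pi_sub]⟩
  left_angle := by simp [S.right_angle, psiLeft_swap σ J θ₂]
  right_angle := by simp [S.left_angle, psiRight_swap σ J θ₁]

/-- The curvature `ψ' = (g y - P₀) / σ`. -/
noncomputable def curv (s : ℝ) : ℝ := (g * S.y s - S.P₀) / σ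

/-- The support function of the surface: the distance of the vertex from the tangent line. -/
noncomputable def support (s : ℝ) : ℝ :=
  S.y s * cos (S.ψ s) - S.x s * sin (S.ψ s)

theorem zero_mem : (0 : ℝ) ∈ Icc 0 S.L := left_mem_Icc.2 S.L_pos.le
theorem L_mem : S.L ∈ Icc 0 S.L := right_mem_Icc.2 S.L_pos.le

theorem reflect_mem {s : ℝ} (hs : s ∈ Icc 0 S.L) : S.L - s ∈ Icc 0 S.L :=
  ⟨by linarith [hs.2], by linarith [hs.1]⟩

theorem ψ_hasDeriv {s : ℝ} (hs : s ∈ Icc 0 S.L) :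
    HasDerivWithinAt S.ψ (S.curv s) (Icc 0 S.L) s := S.ψ_deriv s hs

theorem curv_hasDeriv {s : ℝ} (hs : s ∈ Icc 0 S.L) :
    HasDerivWithinAt S.curv (g / σ * sin (S.ψ s)) (Icc 0 S.L) s := by
  have := (((S.y_deriv s hs).const_mul g).sub_const S.P₀).div_const σ
  exact this.congr_deriv (by ring)

theorem x_cont : ContinuousOn S.x (Icc 0 S.L) := fun s hs => (S.x_deriv s hs).continuousWithinAt
theorem y_cont : ContinuousOn S.y (Icc 0 S.L) := fun s hs => (S.y_deriv s hs).continuousWithinAt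
theorem ψ_cont : ContinuousOn S.ψ (Icc 0 S.L) := fun s hs => (S.ψ_deriv s hs).continuousWithinAt
theorem curv_cont : ContinuousOn S.curv (Icc 0 S.L) :=
  fun _ hs => (S.curv_hasDeriv hs).continuousWithinAt

theorem cos_hasDeriv {s : ℝ} (hs : s ∈ Icc 0 S.L) :
    HasDerivWithinAt (fun t => cos (S.ψ t)) (-sin (S.ψ s) * S.curv s) (Icc 0 S.L) s :=
  (S.ψ_hasDeriv hs).cos

theorem sin_hasDeriv {s : ℝ} (hs : s ∈ Icc 0 S.L) :
    HasDerivWithinAt (fun t => sin (S.ψ t)) (cos (S.ψ s) * S.curv s) (Icc 0 S.L) s :=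
  (S.ψ_hasDeriv hs).sin

/-- The first integral of the pendulum equation `ψ'' = (g / σ) sin ψ`. -/
theorem energy {s : ℝ} (hs : s ∈ Icc 0 S.L) :
    S.curv s ^ 2 / 2 + g / σ * cos (S.ψ s) = S.curv 0 ^ 2 / 2 + g / σ * cos (S.ψ 0) := by
  refine eq_left_of_hasDerivWithinAt_zero (f := fun s => S.curv s ^ 2 / 2 + g / σ * cos (S.ψ s))
    (fun t ht => ?_) hs
  have := (((S.curv_hasDeriv ht).pow 2).div_const 2).add ((S.cos_hasDeriv ht).const_mul (g / σ))
  exact this.congr_deriv (by simp; ring)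

section Negative

variable (hg : 0 < g) (hσ : 0 < σ) (h₁ : psiLeft σ J θ₁ < 0) (h₂ : psiRight σ J θ₂ < 0)

include hg hσ h₁ h₂

/-- At a nonnegative maximum, necessarily interior, the curvature vanishes. If the maximum is
positive, `ψ` crosses `0` before the right contact, where `cos ψ = 1` requires more energy than is
available. If it is `0`, the pendulum rests at an equilibrium and can never leave it. -/
theorem ψ_neg {s : ℝ} (hs : s ∈ Icc 0 S.L) : S.ψ s < 0 := by
  have hκ : 0 < g / σ := div_pos hg hσ
  by_contra! hpos
  obtain ⟨m, hm, hmax⟩ := isCompact_Icc.exists_isMaxOn ⟨s, hs⟩ S.ψ_cont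
  have hm0 : 0 ≤ S.ψ m := hpos.trans (hmax hs)
  have hne0 : m ≠ 0 := by
    rintro rfl; rw [S.left_angle] at hm0; linarith
  have hneL : m ≠ S.L := by
    rintro rfl; rw [S.right_angle] at hm0; linarith
  have hm' : m ∈ Ioo 0 S.L := ⟨lt_of_le_of_ne hm.1 hne0.symm, lt_of_le_of_ne hm.2 hneL⟩
  have hnhds : Icc 0 S.L ∈ 𝓝 m := Icc_mem_nhds hm'.1 hm'.2
  have hU : S.curv m = 0 :=
    IsLocalMax.hasDerivAt_eq_zero (hmax.isLocalMax hnhds) ((S.ψ_hasDeriv hm).hasDerivAt hnhds)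
  have hsub : Icc m S.L ⊆ Icc 0 S.L := Icc_subset_Icc_left hm.1
  rcases hm0.lt_or_eq with hlt | heq
  · obtain ⟨z, hz, hz0⟩ : ∃ z ∈ Icc m S.L, S.ψ z = 0 :=
      intermediate_value_Icc' hm.2 (S.ψ_cont.mono hsub)
        ⟨by rw [S.right_angle]; exact h₂.le, hm0⟩
    have e1 := S.energy (hsub hz)
    have e2 := S.energy hm
    rw [hz0, cos_zero] at e1
    rw [hU] at e2
    have h3 : cos (S.ψ m) < cos 0 :=
      cos_lt_cos_of_nonneg_of_le_pi le_rfl (S.ψ_range m hm).2.le hlt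
    rw [cos_zero] at h3
    nlinarith [sq_nonneg (S.curv z)]
  -- Grönwall argument: the derivative of `curv² + ψ²` is at most `c` times this quantity, so the
  -- weighted quantity decreases from `0` and `ψ` would vanish at the right contact.
  · set c := g / σ + 1 with hc
    have hF : AntitoneOn (fun t => (S.curv t ^ 2 + S.ψ t ^ 2) * exp (-c * t)) (Icc m S.L) := by
      refine antitoneOn_Icc_of_hasDerivWithinAt (f' := fun t =>
        (2 * S.curv t * (g / σ * sin (S.ψ t)) + 2 * S.ψ t * S.curv t) * exp (-c * t) +
          (S.curv t ^ 2 + S.ψ t ^ 2) * (exp (-c * t) * -c)) (fun t ht => ?_) (fun t ht => ?_)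
      · have e : HasDerivWithinAt (fun t => exp (-c * t)) (exp (-c * t) * -c) (Icc 0 S.L) t := by
          simpa using ((hasDerivWithinAt_id t (Icc 0 S.L)).const_mul (-c)).exp
        have := (((S.curv_hasDeriv (hsub ht)).pow 2).add ((S.ψ_hasDeriv (hsub ht)).pow 2)).mul e
        exact (this.mono hsub).congr_deriv (by simp)
      · have hs2 : sin (S.ψ t) ^ 2 ≤ S.ψ t ^ 2 := sq_le_sq.2 abs_sin_le_abs
        have key : 2 * S.curv t * (g / σ * sin (S.ψ t)) + 2 * S.ψ t * S.curv t ≤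
            c * (S.curv t ^ 2 + S.ψ t ^ 2) := by
          have a1 : 2 * S.curv t * sin (S.ψ t) ≤ S.curv t ^ 2 + S.ψ t ^ 2 := by
            nlinarith [sq_nonneg (S.curv t - sin (S.ψ t))]
          have a2 := mul_le_mul_of_nonneg_left a1 hκ.le
          nlinarith [sq_nonneg (S.curv t - S.ψ t)]
        have he := exp_pos (-c * t)
        nlinarith
    have h5 := hF (left_mem_Icc.2 hm.2) (right_mem_Icc.2 hm.2) hm.2
    simp only [hU, ← heq] at h5
    have h6 : S.ψ S.L ≠ 0 := by rw [S.right_angle]; exact h₂.ne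
    have h7 : 0 < (S.curv S.L ^ 2 + S.ψ S.L ^ 2) * exp (-c * S.L) := by positivity
    norm_num at h5 h7
    linarith

theorem sin_ψ_neg {s : ℝ} (hs : s ∈ Icc 0 S.L) : sin (S.ψ s) < 0 :=
  sin_neg_of_neg_of_neg_pi_lt (S.ψ_neg hg hσ h₁ h₂ hs) (S.ψ_range s hs).1

theorem curv_strictAnti : StrictAntiOn S.curv (Icc 0 S.L) :=
  strictAntiOn_Icc_of_hasDerivWithinAt (fun _ hs => S.curv_hasDeriv hs) fun _ hs =>
    mul_neg_of_pos_of_neg (div_pos hg hσ) (S.sin_ψ_neg hg hσ h₁ h₂ (Ioo_subset_Icc_self hs))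

theorem y_strictAnti : StrictAntiOn S.y (Icc 0 S.L) :=
  strictAntiOn_Icc_of_hasDerivWithinAt S.y_deriv fun _ hs =>
    S.sin_ψ_neg hg hσ h₁ h₂ (Ioo_subset_Icc_self hs)

theorem ψ_strictMonoOn {s : ℝ} (hs : s ∈ Icc 0 S.L) (hU : 0 ≤ S.curv s) :
    StrictMonoOn S.ψ (Icc 0 s) := by
  have hsub : Icc 0 s ⊆ Icc 0 S.L := Icc_subset_Icc_right hs.2
  refine strictMonoOn_Icc_of_hasDerivWithinAt (fun t ht => (S.ψ_hasDeriv (hsub ht)).mono hsub)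
    fun t ht => ?_
  exact hU.trans_lt (S.curv_strictAnti hg hσ h₁ h₂ (hsub (Ioo_subset_Icc_self ht)) hs ht.2)

theorem ψ_strictAntiOn {s : ℝ} (hs : s ∈ Icc 0 S.L) (hU : S.curv s ≤ 0) :
    StrictAntiOn S.ψ (Icc s S.L) := by
  have hsub : Icc s S.L ⊆ Icc 0 S.L := Icc_subset_Icc_left hs.1
  refine strictAntiOn_Icc_of_hasDerivWithinAt (fun t ht => (S.ψ_hasDeriv (hsub ht)).mono hsub)
    fun t ht => ?_
  exact (S.curv_strictAnti hg hσ h₁ h₂ hs (hsub (Ioo_subset_Icc_self ht)) ht.1).trans_le hU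

/-- The curvature decreases, so `ψ` rises and then falls and has no interior minimum: if `curv s ≥
0` it has risen since the left end, otherwise it falls until the right end. -/
theorem ψ_lt_of_mem_Ioo {s : ℝ} (hs : s ∈ Ioo 0 S.L) : S.ψ 0 < S.ψ s ∨ S.ψ S.L < S.ψ s := by
  have hs' := Ioo_subset_Icc_self hs
  rcases le_total 0 (S.curv s) with h | h
  · exact Or.inl (S.ψ_strictMonoOn hg hσ h₁ h₂ hs' h (left_mem_Icc.2 hs'.1)
      (right_mem_Icc.2 hs'.1) hs.1)
  · exact Or.inr (S.ψ_strictAntiOn hg hσ h₁ h₂ hs' h (left_mem_Icc.2 hs'.2)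
      (right_mem_Icc.2 hs'.2) hs.2)

variable (hθ₁ : 0 ≤ θ₁) (hθ₂ : 0 ≤ θ₂) (hθ : θ₁ + θ₂ < π)

include hθ₁ hθ₂ hθ

omit hg hσ h₁ h₂ in
theorem y_ends_nonneg : 0 ≤ S.y 0 ∧ 0 ≤ S.y S.L := by
  obtain ⟨r, hr, -, hy⟩ := S.left_contact
  obtain ⟨r', hr', -, hy'⟩ := S.right_contact
  rw [hy, hy', sin_pi_sub]
  exact ⟨mul_nonneg hr.le (sin_nonneg_of_nonneg_of_le_pi hθ₁ (by linarith)),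
    mul_nonneg hr'.le (sin_nonneg_of_nonneg_of_le_pi hθ₂ (by linarith))⟩

theorem y_nonneg_of_neg {s : ℝ} (hs : s ∈ Icc 0 S.L) : 0 ≤ S.y s :=
  (S.y_ends_nonneg hθ₁ hθ₂ hθ).2.trans
    ((S.y_strictAnti hg hσ h₁ h₂).antitoneOn hs S.L_mem hs.2)

theorem support_pos_of_neg {s : ℝ} (hs : s ∈ Icc 0 S.L) : 0 < S.support s := by
  -- `q` is the abscissa at which the tangent line meets the axis `y = 0`, and `support = -sin ψ ·
  -- q`. Its derivative has the sign of the curvature because `y ≥ 0`, so on one side of each point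
  -- `q` is bounded below by its value at an end.
  set q : ℝ → ℝ := fun t => S.x t - S.y t * cos (S.ψ t) / sin (S.ψ t) with hq
  have hsin : ∀ t ∈ Icc 0 S.L, sin (S.ψ t) < 0 := fun t ht => S.sin_ψ_neg hg hσ h₁ h₂ ht
  have hN : ∀ t ∈ Icc 0 S.L, S.support t = -sin (S.ψ t) * q t := by
    intro t ht
    have := (hsin t ht).ne
    simp only [support, hq]
    field_simp
    ring
  have hq' : ∀ t ∈ Icc 0 S.L,
      HasDerivWithinAt q (S.y t / sin (S.ψ t) ^ 2 * S.curv t) (Icc 0 S.L) t := by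
    intro t ht
    have hne := (hsin t ht).ne
    have := (S.x_deriv t ht).sub
      (((S.y_deriv t ht).mul (S.cos_hasDeriv ht)).div (S.sin_hasDeriv ht) hne)
    refine this.congr_deriv ?_
    simp only [Pi.mul_apply]
    field_simp
    have := sin_sq_add_cos_sq (S.ψ t)
    linear_combination (S.y t * S.curv t) * this
  -- At either wall the tangent makes the angle `γ + π/2` with the wall up to orientation, so both
  -- end values of the support function are `r sin (γ + π/2)`.
  have hβ1 : 0 < gammaAngle σ J + π / 2 := by unfold psiRight at h₂; linarith
  have hβ2 : gammaAngle σ J + π / 2 < π := by unfold psiLeft at h₁; linarith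
  have hβ := sin_pos_of_pos_of_lt_pi hβ1 hβ2
  have hN0 : 0 < S.support 0 := by
    obtain ⟨r, hr, hx, hy⟩ := S.left_contact
    have : S.support 0 = r * sin (gammaAngle σ J + π / 2) := by
      have e : gammaAngle σ J + π / 2 = psiLeft σ J θ₁ + θ₁ := by unfold psiLeft; ring
      rw [support, hx, hy, S.left_angle, cos_pi_sub, sin_pi_sub, e, sin_add]
      ring
    rw [this]; positivity
  have hNL : 0 < S.support S.L := by
    obtain ⟨r, hr, hx, hy⟩ := S.right_contact
    have : S.support S.L = r * sin (gammaAngle σ J + π / 2) := by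
      have e : gammaAngle σ J + π / 2 = θ₂ - psiRight σ J θ₂ := by unfold psiRight; ring
      rw [support, hx, hy, S.right_angle, e, sin_sub]
      ring
    rw [this]; positivity
  rw [hN 0 S.zero_mem] at hN0
  rw [hN S.L S.L_mem] at hNL
  have hq0 : 0 < q 0 := pos_of_mul_pos_right hN0 (by linarith [hsin 0 S.zero_mem])
  have hqL : 0 < q S.L := pos_of_mul_pos_right hNL (by linarith [hsin _ S.L_mem])
  have hanti := (S.curv_strictAnti hg hσ h₁ h₂).antitoneOn
  have hy : ∀ t ∈ Icc 0 S.L, 0 ≤ S.y t / sin (S.ψ t) ^ 2 := fun t ht =>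
    div_nonneg (S.y_nonneg_of_neg hg hσ h₁ h₂ hθ₁ hθ₂ hθ ht) (sq_nonneg _)
  rw [hN s hs]
  refine mul_pos (by linarith [hsin s hs]) ?_
  rcases le_total 0 (S.curv s) with h | h
  · have hsub : Icc 0 s ⊆ Icc 0 S.L := Icc_subset_Icc_right hs.2
    have := monotoneOn_Icc_of_hasDerivWithinAt (fun t ht => (hq' t (hsub ht)).mono hsub)
      (fun t ht => mul_nonneg (hy t (hsub ht)) (h.trans (hanti (hsub ht) hs ht.2)))
    exact hq0.trans_le (this (left_mem_Icc.2 hs.1) (right_mem_Icc.2 hs.1) hs.1)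
  · have hsub : Icc s S.L ⊆ Icc 0 S.L := Icc_subset_Icc_left hs.1
    have := antitoneOn_Icc_of_hasDerivWithinAt (fun t ht => (hq' t (hsub ht)).mono hsub)
      (fun t ht => mul_nonpos_of_nonneg_of_nonpos (hy t (hsub ht))
        ((hanti hs (hsub ht) ht.1).trans h))
    exact hqL.trans_le (this (left_mem_Icc.2 hs.2) (right_mem_Icc.2 hs.2) hs.2)

end Negative

theorem mirror_support {s : ℝ} : S.mirror.support s = S.support (S.L - s) := by
  simp [support, mirror]

section SameSign

variable (hg : 0 < g) (hσ : 0 < σ) (hθ₁ : 0 ≤ θ₁) (hθ₂ : 0 ≤ θ₂) (hθ : θ₁ + θ₂ < π)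
  (hsame : 0 < psiLeft σ J θ₁ * psiRight σ J θ₂)

include hg hσ hθ₁ hθ₂ hθ hsame

omit hg hσ hθ₁ hθ₂ hθ in
theorem _root_.Capillary.neg_or_swap_neg :
    (psiLeft σ J θ₁ < 0 ∧ psiRight σ J θ₂ < 0) ∨ (psiLeft σ J θ₂ < 0 ∧ psiRight σ J θ₁ < 0) := by
  rcases pos_and_pos_or_neg_and_neg_of_mul_pos hsame with h | h
  · rw [psiLeft_swap σ J θ₂, psiRight_swap σ J θ₁]
    exact Or.inr ⟨by linarith, by linarith⟩
  · exact Or.inl h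

theorem support_pos {s : ℝ} (hs : s ∈ Icc 0 S.L) : 0 < S.support s := by
  rcases neg_or_swap_neg hsame with h | h
  · exact S.support_pos_of_neg hg hσ h.1 h.2 hθ₁ hθ₂ hθ hs
  · have := S.mirror.support_pos_of_neg hg hσ h.1 h.2 hθ₂ hθ₁ (by linarith) (S.reflect_mem hs)
    simpa [mirror_support] using this

theorem y_nonneg {s : ℝ} (hs : s ∈ Icc 0 S.L) : 0 ≤ S.y s := by
  rcases neg_or_swap_neg hsame with h | h
  · exact S.y_nonneg_of_neg hg hσ h.1 h.2 hθ₁ hθ₂ hθ hs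
  · have := S.mirror.y_nonneg_of_neg hg hσ h.1 h.2 hθ₂ hθ₁ (by linarith) (S.reflect_mem hs)
    simpa [mirror] using this

omit hθ₁ hθ₂ hθ in
theorem abs_ψ_lt {s : ℝ} (hs : s ∈ Ioo 0 S.L) : |S.ψ s| < max |S.ψ 0| |S.ψ S.L| := by
  have key : ∀ {θ₁ θ₂ : ℝ} (S : FreeSurface g σ J θ₁ θ₂), psiLeft σ J θ₁ < 0 → psiRight σ J θ₂ < 0 →
      ∀ {s}, s ∈ Ioo 0 S.L → |S.ψ s| < max |S.ψ 0| |S.ψ S.L| := by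
    intro θ₁ θ₂ S h₁ h₂ s hs
    rw [abs_of_neg (S.ψ_neg hg hσ h₁ h₂ (Ioo_subset_Icc_self hs)),
      abs_of_neg (S.ψ_neg hg hσ h₁ h₂ S.zero_mem), abs_of_neg (S.ψ_neg hg hσ h₁ h₂ S.L_mem),
      lt_max_iff]
    rcases S.ψ_lt_of_mem_Ioo hg hσ h₁ h₂ hs with h | h
    · exact Or.inl (by linarith)
    · exact Or.inr (by linarith)
  rcases neg_or_swap_neg hsame with h | h
  · exact key S h.1 h.2 hs
  · have := key S.mirror h.1 h.2 (s := S.L - s) ⟨by linarith [hs.2], by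
      show S.L - s < S.L; linarith [hs.1]⟩
    simpa [mirror, max_comm] using this

end SameSign

end FreeSurface

end Capillary

/-! ### Polar coordinates: area of a star-shaped region and the polar graph. -/

namespace Capillary

theorem exists_inverse_Icc_of_neg {f f' : ℝ → ℝ} {a b : ℝ} (hab : a ≤ b)
    (hf : ∀ x ∈ Icc a b, HasDerivWithinAt f (f' x) (Icc a b) x)
    (hf' : ∀ x ∈ Ioo a b, f' x < 0) :
    ∃ k : ℝ → ℝ, MapsTo k (Icc (f b) (f a)) (Icc a b) ∧ (∀ y ∈ Icc (f b) (f a), f (k y) = y) ∧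
      (∀ x ∈ Icc a b, k (f x) = x) ∧ ContinuousOn k (Icc (f b) (f a)) ∧
      ∀ y ∈ Icc (f b) (f a), f' (k y) ≠ 0 →
        HasDerivWithinAt k (f' (k y))⁻¹ (Icc (f b) (f a)) y := by
  obtain ⟨k, hk1, hk2, hk3, hk4, hk5⟩ := exists_inverse_Icc (f := fun x => -f x)
    (f' := fun x => -f' x) hab (fun x hx => (hf x hx).neg) (fun x hx => by linarith [hf' x hx])
  have hm : MapsTo (fun y : ℝ => -y) (Icc (f b) (f a)) (Icc (-f a) (-f b)) :=
    fun y hy => ⟨by linarith [hy.2], by linarith [hy.1]⟩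
  refine ⟨fun y => k (-y), fun y hy => hk1 (hm hy), fun y hy => by linarith [hk2 _ (hm hy)],
    hk3, hk4.comp continuous_neg.continuousOn hm, fun y hy h0 => ?_⟩
  have h1 := hk5 (-y) (hm hy) (by simpa using h0)
  have h2 := HasDerivWithinAt.comp y h1 (hasDerivWithinAt_neg y _) hm
  exact h2.congr_deriv (by field_simp)

theorem eq_of_mul_cos_eq_of_mul_sin_eq {r r' t t' : ℝ} (hr : 0 < r) (hr' : 0 < r')
    (ht : t ∈ Ioc (-π) π) (ht' : t' ∈ Ioc (-π) π) (hc : r * cos t = r' * cos t')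
    (hs : r * sin t = r' * sin t') : r = r' ∧ t = t' := by
  have hrr : r = r' := by
    have : r ^ 2 = r' ^ 2 := by
      linear_combination (r * cos t + r' * cos t') * hc + (r * sin t + r' * sin t') * hs -
        r ^ 2 * sin_sq_add_cos_sq t + r' ^ 2 * sin_sq_add_cos_sq t'
    exact (pow_left_inj₀ hr.le hr'.le two_ne_zero).1 this
  subst hrr
  refine ⟨rfl, ?_⟩
  have hc' := mul_left_cancel₀ hr.ne' hc
  have hs' := mul_left_cancel₀ hr.ne' hs
  rw [← Complex.arg_cos_add_sin_mul_I ht, ← Complex.arg_cos_add_sin_mul_I ht',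
    ← Complex.ofReal_cos, ← Complex.ofReal_cos, ← Complex.ofReal_sin, ← Complex.ofReal_sin,
    hc', hs']

/-- The area of a region that is star-shaped about the origin, in polar coordinates. -/
theorem volume_eq_of_polar {ρ : ℝ → ℝ} {α β : ℝ} (hα : 0 ≤ α) (hαβ : α ≤ β) (hβ : β ≤ π)
    (hρ : ContinuousOn ρ (Icc α β)) (hpos : ∀ θ ∈ Icc α β, 0 < ρ θ) {R : Set (ℝ × ℝ)}
    (hR : MeasurableSet R)
    (hmem : ∀ r : ℝ, 0 < r → ∀ θ ∈ Ioo (-π) π,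
      ((r * cos θ, r * sin θ) ∈ R ↔ θ ∈ Icc α β ∧ r ≤ ρ θ)) :
    volume R = ENNReal.ofReal ((1 / 2) * ∫ θ in α..β, ρ θ ^ 2) := by
  have hsymm : Measurable (polarCoord.symm : ℝ × ℝ → ℝ × ℝ) := by
    have : (polarCoord.symm : ℝ × ℝ → ℝ × ℝ) = fun p => (p.1 * cos p.2, p.1 * sin p.2) := by
      ext p <;> simp [polarCoord_symm_apply]
    rw [this]
    fun_prop
  have hmeas : Measurable fun p : ℝ × ℝ =>
      ENNReal.ofReal p.1 • R.indicator (1 : ℝ × ℝ → ENNReal) (polarCoord.symm p) := by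
    have h1 : Measurable fun p : ℝ × ℝ => ENNReal.ofReal p.1 := by fun_prop
    exact h1.smul ((measurable_one.indicator hR).comp hsymm)
  rw [← lintegral_indicator_one hR, ← lintegral_comp_polarCoord_symm, polarCoord_target,
    Measure.volume_eq_prod, ← Measure.prod_restrict, lintegral_prod_symm _ hmeas.aemeasurable]
  have hinner : ∀ θ ∈ Ioo (-π) π, (∫⁻ r in Ioi (0 : ℝ),
      ENNReal.ofReal r • R.indicator (1 : ℝ × ℝ → ENNReal) (polarCoord.symm (r, θ))) =
      (Icc α β).indicator (fun θ => ENNReal.ofReal (ρ θ ^ 2 / 2)) θ := by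
    intro θ hθ
    by_cases hmemθ : θ ∈ Icc α β
    · have h0 := hpos θ hmemθ
      rw [indicator_of_mem hmemθ]
      have e1 : (∫⁻ r in Ioi (0 : ℝ),
          ENNReal.ofReal r • R.indicator (1 : ℝ × ℝ → ENNReal) (polarCoord.symm (r, θ))) =
          ∫⁻ r in Ioi (0 : ℝ), (Iic (ρ θ)).indicator (fun r => ENNReal.ofReal r) r := by
        refine setLIntegral_congr_fun measurableSet_Ioi fun r hr => ?_
        simp only [polarCoord_symm_apply]
        by_cases hle : r ≤ ρ θ
        · rw [indicator_of_mem ((hmem r hr θ hθ).2 ⟨hmemθ, hle⟩),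
            indicator_of_mem (show r ∈ Iic (ρ θ) from hle)]
          simp
        · rw [indicator_of_notMem (fun h => hle ((hmem r hr θ hθ).1 h).2),
            indicator_of_notMem (show r ∉ Iic (ρ θ) from hle)]
          simp
      rw [e1, lintegral_indicator measurableSet_Iic, Measure.restrict_restrict measurableSet_Iic,
        inter_comm, Ioi_inter_Iic,
        ← ofReal_integral_eq_lintegral_ofReal]
      · rw [← intervalIntegral.integral_of_le h0.le, integral_id]
        norm_num
      · exact continuous_id.integrableOn_Ioc
      · exact (ae_restrict_mem measurableSet_Ioc).mono fun r hr => hr.1.le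
    · rw [indicator_of_notMem hmemθ]
      rw [setLIntegral_congr_fun (g := fun _ => 0) measurableSet_Ioi]
      · simp
      · intro r hr
        simp only [polarCoord_symm_apply]
        rw [indicator_of_notMem (fun h => hmemθ ((hmem r hr θ hθ).1 h).1)]
        simp
  rw [setLIntegral_congr_fun measurableSet_Ioo hinner, lintegral_indicator measurableSet_Icc,
    Measure.restrict_restrict measurableSet_Icc]
  -- Polar coordinates omit the ray `θ = π`, which `[α, β]` may contain; it is negligible.
  have hae : (Icc α β ∩ Ioo (-π) π : Set ℝ) =ᵐ[volume] Icc α β := by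
    have h1 : (Ioo (-π) π : Set ℝ) =ᵐ[volume] Icc (-π) π := Ioo_ae_eq_Icc
    have h2 : Icc α β ∩ Icc (-π) π = Icc α β :=
      inter_eq_left.2 (Icc_subset_Icc (by linarith [pi_pos]) hβ)
    have h3 := (Filter.EventuallyEq.refl (ae volume) (Icc α β)).inter h1
    rwa [h2] at h3
  rw [Measure.restrict_congr_set hae, ← ofReal_integral_eq_lintegral_ofReal]
  · rw [intervalIntegral.integral_of_le hαβ, integral_Icc_eq_integral_Ioc,
      ← integral_const_mul]
    congr 1
    refine integral_congr_ae (Eventually.of_forall fun θ => ?_)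
    simp only; ring
  · exact ((hρ.pow 2).div_const 2).integrableOn_Icc
  · exact Eventually.of_forall fun θ => by positivity

namespace FreeSurface

variable {g σ J θ₁ θ₂ : ℝ} (S : FreeSurface g σ J θ₁ θ₂)

/-- The distance to the vertex of the vessel. -/
noncomputable def radius (s : ℝ) : ℝ := √(S.x s ^ 2 + S.y s ^ 2)

/-- The polar angle of a point of the surface. -/
noncomputable def polarAngle (s : ℝ) : ℝ :=
  π / 2 + Complex.arg ((S.y s : ℂ) + ((-S.x s : ℝ) : ℂ) * Complex.I)

/-- The tangential component of the position. -/
noncomputable def tangential (s : ℝ) : ℝ := S.x s * cos (S.ψ s) + S.y s * sin (S.ψ s)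

theorem radius_eq_norm (s : ℝ) :
    S.radius s = ‖(S.y s : ℂ) + ((-S.x s : ℝ) : ℂ) * Complex.I‖ := by
  rw [Complex.norm_add_mul_I, radius]
  congr 1; ring

theorem radius_mul_cos (s : ℝ) : S.radius s * cos (S.polarAngle s) = S.x s := by
  rw [polarAngle, add_comm, cos_add_pi_div_two, radius_eq_norm, mul_neg, Complex.norm_mul_sin_arg]
  simp

theorem radius_mul_sin (s : ℝ) : S.radius s * sin (S.polarAngle s) = S.y s := by
  rw [polarAngle, add_comm, sin_add_pi_div_two, radius_eq_norm, Complex.norm_mul_cos_arg]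
  simp

theorem radius_sq (s : ℝ) : S.radius s ^ 2 = S.x s ^ 2 + S.y s ^ 2 :=
  sq_sqrt (by positivity)

theorem tangential_sq_add_support_sq (s : ℝ) :
    S.tangential s ^ 2 + S.support s ^ 2 = S.radius s ^ 2 := by
  rw [radius_sq, tangential, support]
  linear_combination (S.x s ^ 2 + S.y s ^ 2) * sin_sq_add_cos_sq (S.ψ s)

theorem tangential_hasDeriv {s : ℝ} (hs : s ∈ Icc 0 S.L) :
    HasDerivWithinAt S.tangential (1 + S.curv s * S.support s) (Icc 0 S.L) s := by
  have := ((S.x_deriv s hs).mul (S.cos_hasDeriv hs)).add ((S.y_deriv s hs).mul (S.sin_hasDeriv hs))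
  refine this.congr_deriv ?_
  rw [support]
  linear_combination sin_sq_add_cos_sq (S.ψ s)

theorem support_hasDeriv {s : ℝ} (hs : s ∈ Icc 0 S.L) :
    HasDerivWithinAt S.support (-S.curv s * S.tangential s) (Icc 0 S.L) s := by
  have := ((S.y_deriv s hs).mul (S.cos_hasDeriv hs)).sub ((S.x_deriv s hs).mul (S.sin_hasDeriv hs))
  refine this.congr_deriv ?_
  rw [tangential]
  ring

theorem radius_pos {s : ℝ} (hN : 0 < S.support s) : 0 < S.radius s := by
  refine sqrt_pos.2 ?_
  rw [← radius_sq, ← tangential_sq_add_support_sq]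
  positivity

theorem radius_hasDeriv {s : ℝ} (hs : s ∈ Icc 0 S.L) (hN : 0 < S.support s) :
    HasDerivWithinAt S.radius (S.tangential s / S.radius s) (Icc 0 S.L) s := by
  have h0 : S.x s ^ 2 + S.y s ^ 2 ≠ 0 := by
    rw [← radius_sq]; exact (pow_pos (S.radius_pos hN) 2).ne'
  have := (((S.x_deriv s hs).pow 2).add ((S.y_deriv s hs).pow 2)).sqrt h0
  refine this.congr_deriv ?_
  have h1 : √((S.x ^ 2 + S.y ^ 2) s) = S.radius s := rfl
  rw [h1, tangential]
  have := (S.radius_pos hN).ne'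
  field_simp
  push_cast
  ring

theorem polarAngle_hasDeriv {s : ℝ} (hs : s ∈ Icc 0 S.L) (hN : 0 < S.support s)
    (hy : 0 ≤ S.y s) :
    HasDerivWithinAt S.polarAngle (-S.support s / S.radius s ^ 2) (Icc 0 S.L) s := by
  have hr := S.radius_pos hN
  set z : ℝ → ℂ := fun t => (S.y t : ℂ) + ((-S.x t : ℝ) : ℂ) * Complex.I with hz
  have hre : (z s).re = S.y s := by simp [hz]
  have him : (z s).im = -S.x s := by simp [hz]
  have hnorm : Complex.normSq (z s) = S.radius s ^ 2 := by
    rw [Complex.normSq_apply, hre, him, radius_sq]; ring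
  -- `z` is the position turned by `-π/2`, so the branch cut lies along the negative vertical axis.
  -- The polar angle is thus smooth up to the walls, even on a wall at the angle `π`.
  have hslit : z s ∈ Complex.slitPlane := by
    rw [Complex.mem_slitPlane_iff, hre, him]
    by_contra! h
    have h1 : S.y s = 0 := le_antisymm h.1 hy
    have h2 : S.x s = 0 := by linarith [h.2]
    have := S.radius_sq s
    rw [h1, h2] at this
    nlinarith
  have h1 : HasDerivWithinAt z ((sin (S.ψ s) : ℂ) + ((-cos (S.ψ s) : ℝ) : ℂ) * Complex.I)
      (Icc 0 S.L) s := by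
    have a1 := (S.y_deriv s hs).ofReal_comp
    have a2 := ((S.x_deriv s hs).neg.ofReal_comp).mul_const Complex.I
    refine (a1.add a2).congr_deriv ?_
    push_cast; ring
  have h2 := (Complex.imCLM.hasFDerivAt.comp_hasDerivWithinAt s (h1.clog_real hslit)).const_add
    (π / 2)
  have h3 : S.polarAngle = fun t => π / 2 + (⇑Complex.imCLM ∘ fun t => Complex.log (z t)) t := by
    ext t; simp [polarAngle, hz, Complex.log_im]
  rw [h3]
  refine h2.congr_deriv ?_
  simp only [Complex.imCLM_apply, Complex.div_im, hre, him, hnorm]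
  simp [support, -Complex.ofReal_cos, -Complex.ofReal_sin]
  ring

section Graph

variable (hN : ∀ s ∈ Icc 0 S.L, 0 < S.support s) (hy : ∀ s ∈ Icc 0 S.L, 0 ≤ S.y s)
  (hθ₁ : 0 ≤ θ₁) (hθ₂ : 0 ≤ θ₂) (hθ : θ₁ + θ₂ < π)

include hθ₁ hθ₂ hθ

theorem polarAngle_zero : S.polarAngle 0 = π - θ₁ := by
  obtain ⟨r, hr, h1, h2⟩ := S.left_contact
  have := Complex.arg_mul_cos_add_sin_mul_I hr (θ := π / 2 - θ₁)
    ⟨by linarith, by linarith [pi_pos]⟩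
  rw [polarAngle, h1, h2, cos_pi_sub, sin_pi_sub]
  rw [← Complex.ofReal_cos, ← Complex.ofReal_sin, cos_pi_div_two_sub, sin_pi_div_two_sub] at this
  have e : (((r * sin θ₁ : ℝ) : ℂ) + ((-(r * -cos θ₁) : ℝ) : ℂ) * Complex.I) =
      (r : ℂ) * ((sin θ₁ : ℝ) + (cos θ₁ : ℝ) * Complex.I) := by
    push_cast; ring
  rw [e, this]; ring

theorem polarAngle_L : S.polarAngle S.L = θ₂ := by
  obtain ⟨r, hr, h1, h2⟩ := S.right_contact
  have := Complex.arg_mul_cos_add_sin_mul_I hr (θ := θ₂ - π / 2)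
    ⟨by linarith [pi_pos], by linarith [pi_pos]⟩
  rw [polarAngle, h1, h2]
  rw [← Complex.ofReal_cos, ← Complex.ofReal_sin, cos_sub_pi_div_two, sin_sub_pi_div_two] at this
  have e : (((r * sin θ₂ : ℝ) : ℂ) + ((-(r * cos θ₂) : ℝ) : ℂ) * Complex.I) =
      (r : ℂ) * ((sin θ₂ : ℝ) + ((-cos θ₂ : ℝ) : ℂ) * Complex.I) := by
    push_cast; ring
  rw [e, this]; ring

include hN hy

omit hθ₁ hθ₂ hθ in
theorem polarAngle_strictAnti : StrictAntiOn S.polarAngle (Icc 0 S.L) :=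
  strictAntiOn_Icc_of_hasDerivWithinAt (fun s hs => S.polarAngle_hasDeriv hs (hN s hs) (hy s hs))
    fun s hs => by
      have h := hN s (Ioo_subset_Icc_self hs)
      have := S.radius_pos h
      rw [neg_div]
      exact neg_neg_of_pos (by positivity)

theorem polarAngle_mem {s : ℝ} (hs : s ∈ Icc 0 S.L) : S.polarAngle s ∈ angles θ₁ θ₂ := by
  have h := (S.polarAngle_strictAnti hN hy).antitoneOn
  rw [angles, ← S.polarAngle_zero hθ₁ hθ₂ hθ]
  refine ⟨?_, h S.zero_mem hs hs.1⟩
  conv_lhs => rw [← S.polarAngle_L hθ₁ hθ₂ hθ]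
  exact h hs S.L_mem hs.2

theorem exists_polar_inverse : ∃ k : ℝ → ℝ, MapsTo k (angles θ₁ θ₂) (Icc 0 S.L) ∧
    (∀ θ ∈ angles θ₁ θ₂, S.polarAngle (k θ) = θ) ∧ (∀ s ∈ Icc 0 S.L, k (S.polarAngle s) = s) ∧
    ∀ θ ∈ angles θ₁ θ₂, HasDerivWithinAt k (-(S.radius (k θ) ^ 2 / S.support (k θ)))
      (angles θ₁ θ₂) θ := by
  obtain ⟨k, hk1, hk2, hk3, -, hk5⟩ := exists_inverse_Icc_of_neg S.L_pos.le
    (fun s hs => S.polarAngle_hasDeriv hs (hN s hs) (hy s hs)) fun s hs => by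
      have h := hN s (Ioo_subset_Icc_self hs)
      have := S.radius_pos h
      rw [neg_div]
      exact neg_neg_of_pos (by positivity)
  rw [S.polarAngle_zero hθ₁ hθ₂ hθ, S.polarAngle_L hθ₁ hθ₂ hθ] at hk1 hk2 hk5
  refine ⟨k, hk1, hk2, hk3, fun θ hθ => ?_⟩
  have h := hN _ (hk1 hθ)
  have hr := S.radius_pos h
  refine (hk5 θ hθ ?_).congr_deriv ?_
  · rw [neg_div]
    exact (neg_neg_of_pos (by positivity)).ne
  · field_simp

omit hN hy hθ₁ hθ₂ hθ in
theorem measurableSet_region : MeasurableSet S.region := by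
  have : S.region = (fun p : ℝ × ℝ => (p.2 * S.x p.1, p.2 * S.y p.1)) ''
      (Icc 0 S.L ×ˢ Icc (0 : ℝ) 1) := by
    ext p
    constructor
    · rintro ⟨s, hs, t, ht, rfl⟩
      exact ⟨(s, t), ⟨hs, ht⟩, rfl⟩
    · rintro ⟨⟨s, t⟩, ⟨hs, ht⟩, rfl⟩
      exact ⟨s, hs, t, ht, rfl⟩
  rw [this]
  refine ((isCompact_Icc.prod isCompact_Icc).image_of_continuousOn ?_).isClosed.measurableSet
  have hm : MapsTo Prod.fst (Icc 0 S.L ×ˢ Icc (0 : ℝ) 1) (Icc 0 S.L) := fun p hp => hp.1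
  exact (continuous_snd.continuousOn.mul (S.x_cont.comp continuous_fst.continuousOn hm)).prodMk
    (continuous_snd.continuousOn.mul (S.y_cont.comp continuous_fst.continuousOn hm))

/-- With `r`, `M`, `N` the radius and the tangential and normal parts of the position, `r' = M/r`,
`θ' = -N/r²` and `M² + N² = r²`. Hence `ρ' = -rM/N`, `√(ρ² + ρ'²) = r²/N`, and the flux is `-M/r`:
minus the cosine of the angle between position and tangent. Its end values are the contact
conditions, and its derivative produces the curvature. -/
theorem exists_polar_graph (hσ : 0 < σ) (hJ : |J| ≤ σ) : ∃ ρ : ℝ → ℝ, PolarSystem g σ J θ₁ θ₂ S.P₀ ρ ∧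
    S.trace = (fun θ => (ρ θ * cos θ, ρ θ * sin θ)) '' angles θ₁ θ₂ ∧
    S.vol = ENNReal.ofReal (polarVolume θ₁ θ₂ ρ) ∧
    polarVolume θ₁ θ₂ ρ = (1 / 2) * ∫ s in 0..S.L, S.support s := by
  obtain ⟨k, hmaps, hright, hleft, hderiv⟩ := S.exists_polar_inverse hN hy hθ₁ hθ₂ hθ
  have hlt : θ₂ < π - θ₁ := by linarith
  have hu : UniqueDiffOn ℝ (angles θ₁ θ₂) := uniqueDiffOn_Icc hlt
  have hkc : ContinuousOn k (angles θ₁ θ₂) := fun θ h => (hderiv θ h).continuousWithinAt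
  have hNc : ContinuousOn S.support (Icc 0 S.L) :=
    fun s hs => (S.support_hasDeriv hs).continuousWithinAt
  have hMc : ContinuousOn S.tangential (Icc 0 S.L) :=
    fun s hs => (S.tangential_hasDeriv hs).continuousWithinAt
  have hrc : ContinuousOn S.radius (Icc 0 S.L) :=
    fun s hs => (S.radius_hasDeriv hs (hN s hs)).continuousWithinAt
  have hr : ∀ s ∈ Icc 0 S.L, 0 < S.radius s := fun s hs => S.radius_pos (hN s hs)
  have hchain : ∀ {F F' : ℝ → ℝ}, (∀ s ∈ Icc 0 S.L, HasDerivWithinAt F (F' s) (Icc 0 S.L) s) →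
      ∀ θ ∈ angles θ₁ θ₂, HasDerivWithinAt (fun t => F (k t))
        (F' (k θ) * -(S.radius (k θ) ^ 2 / S.support (k θ))) (angles θ₁ θ₂) θ :=
    fun hF θ h => HasDerivWithinAt.comp θ (hF _ (hmaps h)) (hderiv θ h) hmaps
  set ρ : ℝ → ℝ := fun θ => S.radius (k θ) with hρ
  set ρ' : ℝ → ℝ := fun θ => -(S.radius (k θ) * S.tangential (k θ) / S.support (k θ)) with hρ'
  have hd1 : ∀ θ ∈ angles θ₁ θ₂, HasDerivWithinAt ρ (ρ' θ) (angles θ₁ θ₂) θ := by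
    intro θ h
    refine (hchain (fun s hs => S.radius_hasDeriv hs (hN s hs)) θ h).congr_deriv ?_
    have h1 := hr _ (hmaps h)
    have h2 := hN _ (hmaps h)
    simp only [hρ']
    field_simp
  have hdw : ∀ θ ∈ angles θ₁ θ₂, derivWithin ρ (angles θ₁ θ₂) θ = ρ' θ :=
    fun θ h => (hd1 θ h).derivWithin (hu θ h)
  have hsqrt : ∀ θ ∈ angles θ₁ θ₂, √(ρ θ ^ 2 + derivWithin ρ (angles θ₁ θ₂) θ ^ 2) =
      S.radius (k θ) ^ 2 / S.support (k θ) := by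
    intro θ h
    have h1 := hr _ (hmaps h)
    have h2 := hN _ (hmaps h)
    rw [hdw θ h, sqrt_eq_iff_mul_self_eq (by positivity) (by positivity)]
    simp only [hρ, hρ']
    field_simp
    linear_combination S.tangential_sq_add_support_sq (k θ)
  have hflux : ∀ θ ∈ angles θ₁ θ₂,
      polarFlux θ₁ θ₂ ρ θ = -(S.tangential (k θ) / S.radius (k θ)) := by
    intro θ h
    have h1 := hr _ (hmaps h)
    have h2 := hN _ (hmaps h)
    rw [polarFlux, hsqrt θ h, hdw θ h]
    simp only [hρ']
    field_simp
  have hflux' : ∀ θ ∈ angles θ₁ θ₂, derivWithin (polarFlux θ₁ θ₂ ρ) (angles θ₁ θ₂) θ =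
      S.support (k θ) / S.radius (k θ) + S.curv (k θ) * S.radius (k θ) := by
    intro θ h
    have h1 := hr _ (hmaps h)
    have h2 := hN _ (hmaps h)
    have h3 := hchain (fun s hs => ((S.tangential_hasDeriv hs).div
      (S.radius_hasDeriv hs (hN s hs)) (hr s hs).ne').neg) θ h
    have h4 := (h3.congr hflux (hflux θ h)).derivWithin (hu θ h)
    rw [h4]
    field_simp
    linear_combination -S.tangential_sq_add_support_sq (k θ)
  have hC2 : ContDiffOn ℝ 2 ρ (angles θ₁ θ₂) := by
    refine contDiffOn_two_of_hasDerivWithinAt hu hd1 (hchain (fun s hs => (((S.radius_hasDeriv hs (hN s hs)).mul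
      (S.tangential_hasDeriv hs)).div (S.support_hasDeriv hs) (hN s hs).ne').neg)) ?_
    have hr0 : ∀ s ∈ Icc 0 S.L, S.radius s ≠ 0 := fun s hs => (hr s hs).ne'
    have hN0 : ∀ s ∈ Icc 0 S.L, S.support s ≠ 0 := fun s hs => (hN s hs).ne'
    have hUc := S.curv_cont
    refine ContinuousOn.comp (t := Icc 0 S.L) (g := fun s =>
      -(((S.tangential s / S.radius s * S.tangential s + S.radius s *
        (1 + S.curv s * S.support s)) * S.support s - S.radius s * S.tangential s *
        (-S.curv s * S.tangential s)) / S.support s ^ 2) * -(S.radius s ^ 2 / S.support s))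
      ?_ hkc hmaps
    have hN2 : ∀ s ∈ Icc 0 S.L, S.support s ^ 2 ≠ 0 := fun s hs => pow_ne_zero 2 (hN0 s hs)
    fun_prop (disch := assumption)
  have hends : S.tangential 0 = S.radius 0 * cos (psiLeft σ J θ₁ - (π - θ₁)) ∧
      S.tangential S.L = S.radius S.L * cos (psiRight σ J θ₂ - θ₂) := by
    constructor
    · rw [tangential, ← S.radius_mul_cos, ← S.radius_mul_sin, S.polarAngle_zero hθ₁ hθ₂ hθ,
        S.left_angle,
        cos_sub (psiLeft σ J θ₁)]
      ring
    · rw [tangential, ← S.radius_mul_cos, ← S.radius_mul_sin, S.polarAngle_L hθ₁ hθ₂ hθ,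
        S.right_angle,
        cos_sub (psiRight σ J θ₂)]
      ring
  have hsinγ : sin (gammaAngle σ J) = -J / σ := by
    have h := abs_le.1 hJ
    exact sin_arcsin (by rw [le_div_iff₀ hσ]; linarith [h.2])
      (by rw [div_le_iff₀ hσ]; linarith [h.1])
  have hk0 : k (π - θ₁) = 0 := by
    rw [← S.polarAngle_zero hθ₁ hθ₂ hθ]; exact hleft 0 S.zero_mem
  have hkL : k θ₂ = S.L := by
    conv_lhs => rw [← S.polarAngle_L hθ₁ hθ₂ hθ]
    exact hleft S.L S.L_mem
  refine ⟨ρ, ⟨fun θ h => hr _ (hmaps h), hC2, fun θ h => ?_, ?_, ?_⟩, ?_, ?_, ?_⟩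
  · have h1 := hr _ (hmaps h)
    have h2 := hN _ (hmaps h)
    have hsin := S.radius_mul_sin (k θ)
    rw [hright θ h] at hsin
    have hU : σ * S.curv (k θ) = g * S.y (k θ) - S.P₀ := by
      rw [curv]; field_simp
    rw [hsqrt θ h, hflux' θ h]
    simp only [hρ]
    field_simp
    linear_combination (g * S.radius (k θ) ^ 2) * hsin - S.radius (k θ) ^ 2 * hU
  · rw [hflux θ₂ (left_mem_Icc.2 hlt.le), hkL, hends.2,
      mul_div_cancel_left₀ _ (hr _ S.L_mem).ne']
    have : psiRight σ J θ₂ - θ₂ = -(gammaAngle σ J + π / 2) := by unfold psiRight; ring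
    rw [this, cos_neg, cos_add_pi_div_two, hsinγ]
    ring
  · rw [hflux _ (right_mem_Icc.2 hlt.le), hk0, hends.1,
      mul_div_cancel_left₀ _ (hr _ S.zero_mem).ne']
    have : psiLeft σ J θ₁ - (π - θ₁) = gammaAngle σ J - π / 2 := by unfold psiLeft; ring
    rw [this, cos_sub_pi_div_two, hsinγ]
    ring
  · rw [trace]
    ext p
    constructor
    · rintro ⟨s, hs, rfl⟩
      refine ⟨S.polarAngle s, S.polarAngle_mem hN hy hθ₁ hθ₂ hθ hs, ?_⟩
      simp only [hρ, hleft s hs, radius_mul_cos, radius_mul_sin]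
    · rintro ⟨θ, h, rfl⟩
      refine ⟨k θ, hmaps h, ?_⟩
      simp only [hρ]
      rw [← S.radius_mul_cos, ← S.radius_mul_sin, hright θ h]
  · refine volume_eq_of_polar hθ₂ hlt.le (by linarith)
      (fun θ h => (hd1 θ h).continuousWithinAt) (fun θ h => hr _ (hmaps h))
      S.measurableSet_region fun r hr0 θ hθ' => ⟨?_, ?_⟩
    · rintro ⟨s, hs, t, ht, hp⟩
      rw [Prod.mk.injEq] at hp
      have ht0 : 0 < t := by
        refine lt_of_le_of_ne ht.1 ?_
        rintro rfl
        have h1 := sin_sq_add_cos_sq θ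
        have h2 : cos θ = 0 := by simpa [hr0.ne'] using hp.1
        have h3 : sin θ = 0 := by simpa [hr0.ne'] using hp.2
        rw [h2, h3] at h1
        norm_num at h1
      have hmem := S.polarAngle_mem hN hy hθ₁ hθ₂ hθ hs
      obtain ⟨e1, e2⟩ := eq_of_mul_cos_eq_of_mul_sin_eq hr0 (mul_pos ht0 (hr s hs))
        (Ioo_subset_Ioc_self hθ') (t' := S.polarAngle s)
        ⟨by linarith [hmem.1, pi_pos], by linarith [hmem.2]⟩
        (by rw [hp.1, mul_assoc, radius_mul_cos]) (by rw [hp.2, mul_assoc, radius_mul_sin])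
      rw [e2]
      refine ⟨hmem, ?_⟩
      simp only [hρ, hleft s hs]
      rw [e1]
      exact mul_le_of_le_one_left (hr s hs).le ht.2
    · rintro ⟨h, hle⟩
      have h1 := hr _ (hmaps h)
      refine ⟨k θ, hmaps h, r / S.radius (k θ), ⟨by positivity, (div_le_one h1).2 hle⟩, ?_⟩
      rw [← S.radius_mul_cos, ← S.radius_mul_sin, hright θ h]
      ext <;> field_simp
  · rw [polarVolume]
    congr 1
    -- The substitution `θ = polarAngle s` turns `ρ² dθ` into `-support ds`; the sign is absorbed by
    -- the reversed orientation.
    have hsub := intervalIntegral.integral_comp_mul_deriv'' (a := 0) (b := S.L)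
      (f := S.polarAngle) (f' := fun s => -S.support s / S.radius s ^ 2) (g := fun θ => ρ θ ^ 2)
      (by
        rw [uIcc_of_le S.L_pos.le]
        exact fun s hs => (S.polarAngle_hasDeriv hs (hN s hs) (hy s hs)).continuousWithinAt)
      (by
        rw [min_eq_left S.L_pos.le, max_eq_right S.L_pos.le]
        intro s hs
        have hs' := Ioo_subset_Icc_self hs
        exact ((S.polarAngle_hasDeriv hs' (hN s hs') (hy s hs')).hasDerivAt
          (Icc_mem_nhds hs.1 hs.2)).hasDerivWithinAt)
      (by
        rw [uIcc_of_le S.L_pos.le]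
        exact hNc.neg.div (hrc.pow 2) fun s hs => pow_ne_zero 2 (hr s hs).ne')
      (by
        rw [uIcc_of_le S.L_pos.le]
        refine ContinuousOn.mono (s := angles θ₁ θ₂)
          (fun θ h => ((hd1 θ h).continuousWithinAt.pow 2)) ?_
        rintro _ ⟨s, hs, rfl⟩
        exact S.polarAngle_mem hN hy hθ₁ hθ₂ hθ hs)
    rw [S.polarAngle_zero hθ₁ hθ₂ hθ, S.polarAngle_L hθ₁ hθ₂ hθ] at hsub
    rw [intervalIntegral.integral_symm (π - θ₁) θ₂, ← hsub, ← intervalIntegral.integral_neg]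
    refine intervalIntegral.integral_congr fun s hs => ?_
    rw [uIcc_of_le S.L_pos.le] at hs
    have := hr s hs
    simp only [Function.comp, hρ, hleft s hs]
    field_simp

end Graph

end FreeSurface

end Capillary

/-! ### The Cartesian graph, and the swept area in closed form. -/

namespace Capillary

namespace FreeSurface

variable {g σ J θ₁ θ₂ : ℝ} (S : FreeSurface g σ J θ₁ θ₂)

/-- Since `v' = tan ψ`, the flux `v'/√(1 + v'²)` is `sin ψ`, which stays continuous up to a vertical
contact although `v'` does not; the bound on `ψ` is needed only inside. -/
theorem exists_cartesian_graph (hσ : 0 < σ) (hψ : ∀ s ∈ Ioo 0 S.L, |S.ψ s| < π / 2) :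
    ∃ v : ℝ → ℝ, CartesianSystem g σ (psiLeft σ J θ₁) (psiRight σ J θ₂) S.P₀ (S.x 0) (S.x S.L) v ∧
      S.trace = (fun x => (x, v x)) '' Icc (S.x 0) (S.x S.L) := by
  have hcos : ∀ s ∈ Ioo 0 S.L, 0 < cos (S.ψ s) := fun s hs => cos_pos_of_mem_Ioo (abs_lt.1 (hψ s hs))
  obtain ⟨k, hmaps, hright, hleft, hkc, hderiv⟩ := exists_inverse_Icc S.L_pos.le S.x_deriv hcos
  have hx := strictMonoOn_Icc_of_hasDerivWithinAt S.x_deriv hcos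
  have hlt : S.x 0 < S.x S.L := hx S.zero_mem S.L_mem S.L_pos
  have hk0 : k (S.x 0) = 0 := hleft 0 S.zero_mem
  have hkL : k (S.x S.L) = S.L := hleft S.L S.L_mem
  have hmaps' : MapsTo k (Ioo (S.x 0) (S.x S.L)) (Ioo 0 S.L) := by
    intro x hx'
    have h1 := hmaps (Ioo_subset_Icc_self hx')
    have h2 := hright x (Ioo_subset_Icc_self hx')
    refine ⟨lt_of_le_of_ne h1.1 fun h => ?_, lt_of_le_of_ne h1.2 fun h => ?_⟩
    · rw [← h] at h2; exact hx'.1.ne h2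
    · rw [h] at h2; exact hx'.2.ne h2.symm
  have hchain : ∀ {F F' : ℝ → ℝ}, (∀ s ∈ Icc 0 S.L, HasDerivWithinAt F (F' s) (Icc 0 S.L) s) →
      ∀ x ∈ Ioo (S.x 0) (S.x S.L), HasDerivAt (fun t => F (k t))
        (F' (k x) * (cos (S.ψ (k x)))⁻¹) x := by
    intro F F' hF x hx'
    have h1 := (hderiv x (Ioo_subset_Icc_self hx') (hcos _ (hmaps' hx')).ne').hasDerivAt
      (Icc_mem_nhds hx'.1 hx'.2)
    have h2 := (hF _ (Ioo_subset_Icc_self (hmaps' hx'))).hasDerivAt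
      (Icc_mem_nhds (hmaps' hx').1 (hmaps' hx').2)
    exact h2.comp x h1
  have hd1 : ∀ x ∈ Ioo (S.x 0) (S.x S.L), HasDerivAt (fun t => S.y (k t))
      (sin (S.ψ (k x)) * (cos (S.ψ (k x)))⁻¹) x := hchain S.y_deriv
  have hflux : ∀ x ∈ Ioo (S.x 0) (S.x S.L), deriv (fun t => S.y (k t)) x /
      √(1 + deriv (fun t => S.y (k t)) x ^ 2) = sin (S.ψ (k x)) := by
    intro x hx'
    have hc := hcos _ (hmaps' hx')
    have hs : √(1 + (sin (S.ψ (k x)) * (cos (S.ψ (k x)))⁻¹) ^ 2) = (cos (S.ψ (k x)))⁻¹ := by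
      rw [sqrt_eq_iff_mul_self_eq (by positivity) (by positivity)]
      field_simp
      linear_combination sin_sq_add_cos_sq (S.ψ (k x))
    rw [(hd1 x hx').deriv, hs]
    field_simp
  have hsc : ContinuousOn (fun x => sin (S.ψ (k x))) (Icc (S.x 0) (S.x S.L)) :=
    continuous_sin.comp_continuousOn (S.ψ_cont.comp hkc hmaps)
  refine ⟨fun x => S.y (k x), ⟨hlt, S.y_cont.comp hkc hmaps, ?_, ?_, ?_, ?_⟩, ?_⟩
  · refine contDiffOn_two_of_hasDerivWithinAt isOpen_Ioo.uniqueDiffOn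
      (fun x hx' => (hd1 x hx').hasDerivWithinAt)
      (f'' := fun x => S.curv (k x) * (cos (S.ψ (k x)))⁻¹ ^ 3) (fun x hx' => ?_) ?_
    · have hc := (hcos _ (hmaps' hx')).ne'
      have h1 := (hchain (fun s hs => S.sin_hasDeriv hs) x hx').mul
        ((hchain (fun s hs => S.cos_hasDeriv hs) x hx').inv hc)
      refine HasDerivAt.hasDerivWithinAt (h1.congr_deriv ?_)
      simp only [Pi.inv_apply]
      field_simp
      linear_combination S.curv (k x) * sin_sq_add_cos_sq (S.ψ (k x))
    · have hkc' := hkc.mono Ioo_subset_Icc_self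
      have hm : MapsTo k (Ioo (S.x 0) (S.x S.L)) (Icc 0 S.L) :=
        fun x hx' => Ioo_subset_Icc_self (hmaps' hx')
      refine (S.curv_cont.comp hkc' hm).mul (ContinuousOn.pow (ContinuousOn.inv₀ ?_ ?_) 3)
      · exact continuous_cos.comp_continuousOn (S.ψ_cont.comp hkc' hm)
      · exact fun x hx' => (hcos _ (hmaps' hx')).ne'
  · intro x hx'
    have hc := (hcos _ (hmaps' hx')).ne'
    have h1 := hchain (fun s hs => S.sin_hasDeriv hs) x hx'
    have h2 : (fun t => deriv (fun t => S.y (k t)) t /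
        √(1 + deriv (fun t => S.y (k t)) t ^ 2)) =ᶠ[𝓝 x] fun t => sin (S.ψ (k t)) :=
      (eventually_of_mem (Ioo_mem_nhds hx'.1 hx'.2) hflux)
    rw [h2.deriv_eq, h1.deriv, curv]
    field_simp
  · have h1 : Tendsto (fun x => sin (S.ψ (k x))) (𝓝[>] (S.x 0)) (𝓝 (sin (psiLeft σ J θ₁))) := by
      have := hsc (S.x 0) (left_mem_Icc.2 hlt.le)
      rw [ContinuousWithinAt, hk0, S.left_angle] at this
      rw [← nhdsWithin_Ioo_eq_nhdsGT hlt]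
      exact this.mono_left (nhdsWithin_mono _ Ioo_subset_Icc_self)
    exact h1.congr' (eventually_of_mem (Ioo_mem_nhdsGT hlt) fun x hx' => (hflux x hx').symm)
  · have h1 : Tendsto (fun x => sin (S.ψ (k x))) (𝓝[<] (S.x S.L)) (𝓝 (sin (psiRight σ J θ₂))) := by
      have := hsc (S.x S.L) (right_mem_Icc.2 hlt.le)
      rw [ContinuousWithinAt, hkL, S.right_angle] at this
      rw [← nhdsWithin_Ioo_eq_nhdsLT hlt]
      exact this.mono_left (nhdsWithin_mono _ Ioo_subset_Icc_self)
    exact h1.congr' (eventually_of_mem (Ioo_mem_nhdsLT hlt) fun x hx' => (hflux x hx').symm)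
  · rw [trace]
    ext p
    constructor
    · rintro ⟨s, hs, rfl⟩
      exact ⟨S.x s, ⟨hx.monotoneOn S.zero_mem hs hs.1, hx.monotoneOn hs S.L_mem hs.2⟩,
        by simp [hleft s hs]⟩
    · rintro ⟨x, h, rfl⟩
      exact ⟨k x, hmaps h, by simp [hright x h]⟩

/-- A primitive of half the support function. -/
noncomputable def sweptArea (s : ℝ) : ℝ :=
  (σ * sin (S.ψ s) + S.P₀ * S.x s) / g - S.x s * S.y s / 2

theorem half_integral_support (hg : 0 < g) (hσ : 0 < σ) :
    (1 / 2) * ∫ s in 0..S.L, S.support s = S.sweptArea S.L - S.sweptArea 0 := by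
  rw [← intervalIntegral.integral_const_mul]
  have hd : ∀ s ∈ Icc 0 S.L,
      HasDerivWithinAt S.sweptArea (1 / 2 * S.support s) (Icc 0 S.L) s := by
    intro s hs
    have h1 := ((((S.sin_hasDeriv hs).const_mul σ).add ((S.x_deriv s hs).const_mul S.P₀)).div_const
      g).sub (((S.x_deriv s hs).mul (S.y_deriv s hs)).div_const 2)
    refine h1.congr_deriv ?_
    rw [curv, support]
    field_simp
    ring
  refine intervalIntegral.integral_eq_sub_of_hasDerivAt_of_le S.L_pos.le
    (fun s hs => (hd s hs).continuousWithinAt) (fun s hs =>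
      (hd s (Ioo_subset_Icc_self hs)).hasDerivAt (Icc_mem_nhds hs.1 hs.2)) ?_
  refine (ContinuousOn.const_smul (c := (1 / 2 : ℝ)) ?_).intervalIntegrable_of_Icc S.L_pos.le
  exact fun s hs => (S.support_hasDeriv hs).continuousWithinAt

end FreeSurface

end Capillary

/-! ### The depth profile and the divergence of its length integral. -/

namespace Capillary

/-- The cosine of the slope angle as a function of the normalized depth `τ ∈ [0, 1]`. -/
noncomputable def profileCos (C₁ C₂ k τ : ℝ) : ℝ := (1 - τ) * C₁ + τ * C₂ + k * (τ * (1 - τ))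

/-- Minus the sine of the slope angle as a function of the normalized depth. -/
noncomputable def profileSin (C₁ C₂ k τ : ℝ) : ℝ := √(1 - profileCos C₁ C₂ k τ ^ 2)

/-- The ratio of the horizontal extent to the vertical drop. -/
noncomputable def profileInt (C₁ C₂ k : ℝ) : ℝ :=
  ∫ τ in (0 : ℝ)..1, profileCos C₁ C₂ k τ / profileSin C₁ C₂ k τ

/-- The value of the parameter at which the profile becomes infinitely long. -/
noncomputable def profileSup (C₁ C₂ : ℝ) : ℝ := (√(1 - C₁) + √(1 - C₂)) ^ 2

/-- The depth at which the critical profile becomes horizontal. -/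
noncomputable def profilePeak (C₁ C₂ : ℝ) : ℝ := √(1 - C₁) / (√(1 - C₁) + √(1 - C₂))

section Profile

variable {C₁ C₂ : ℝ} (h₁ : C₁ < 1) (h₂ : C₂ < 1)

include h₁ h₂

theorem sum_sqrt_pos : 0 < √(1 - C₁) + √(1 - C₂) := by
  have := sqrt_pos.2 (sub_pos.2 h₁)
  have := sqrt_pos.2 (sub_pos.2 h₂)
  positivity

/-- Completing the square: for `k = profileSup` the profile touches the value `1` at a double point,
namely `profilePeak`, and for smaller `k` a positive term remains inside. -/
theorem one_sub_profileCos (k τ : ℝ) : 1 - profileCos C₁ C₂ k τ =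
    (√(1 - C₁) * (1 - τ) - √(1 - C₂) * τ) ^ 2 + (profileSup C₁ C₂ - k) * (τ * (1 - τ)) := by
  have e1 := sq_sqrt (sub_pos.2 h₁).le
  have e2 := sq_sqrt (sub_pos.2 h₂).le
  unfold profileCos profileSup
  linear_combination (-(1 - τ)) * e1 - τ * e2

theorem one_sub_profileCos' (k τ : ℝ) : 1 - profileCos C₁ C₂ k τ =
    profileSup C₁ C₂ * (τ - profilePeak C₁ C₂) ^ 2 + (profileSup C₁ C₂ - k) * (τ * (1 - τ)) := by
  rw [one_sub_profileCos h₁ h₂, profilePeak]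
  have := sum_sqrt_pos h₁ h₂
  rw [profileSup]
  field_simp
  ring

theorem profilePeak_mem : profilePeak C₁ C₂ ∈ Ioo 0 1 := by
  have a1 := sqrt_pos.2 (sub_pos.2 h₁)
  have a2 := sqrt_pos.2 (sub_pos.2 h₂)
  rw [profilePeak]
  exact ⟨by positivity, by rw [div_lt_one (by positivity)]; linarith⟩

theorem profileCos_lt_one {k τ : ℝ} (hk : k < profileSup C₁ C₂) (hτ : τ ∈ Icc (0 : ℝ) 1) :
    profileCos C₁ C₂ k τ < 1 := by
  have h := one_sub_profileCos h₁ h₂ k τ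
  have a1 := sqrt_pos.2 (sub_pos.2 h₁)
  have a2 := sqrt_pos.2 (sub_pos.2 h₂)
  rw [← sub_pos, h]
  rcases hτ.1.eq_or_lt with h0 | h0
  · rw [← h0]; simp; positivity
  rcases hτ.2.eq_or_lt with h0' | h0'
  · rw [h0']; simp; positivity
  have : 0 < (profileSup C₁ C₂ - k) * (τ * (1 - τ)) :=
    mul_pos (by linarith) (mul_pos h0 (by linarith))
  positivity

theorem lt_profileSup_of_profileCos_lt_one {k : ℝ}
    (hk : profileCos C₁ C₂ k (profilePeak C₁ C₂) < 1) : k < profileSup C₁ C₂ := by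
  have h := one_sub_profileCos' h₁ h₂ k (profilePeak C₁ C₂)
  have hp := profilePeak_mem h₁ h₂
  rw [sub_self, zero_pow two_ne_zero, mul_zero, zero_add] at h
  have h3 : 0 < profilePeak C₁ C₂ * (1 - profilePeak C₁ C₂) := mul_pos hp.1 (by linarith [hp.2])
  by_contra! h4
  nlinarith

/-- With `a = √(1 - C₁)` and `b = √(1 - C₂)` this is `|a² - b²| < (a + b)²`. It leaves room for
surfaces of interior type, that is `h₀ < hₘ`. -/
theorem abs_sub_lt_profileSup : |C₂ - C₁| < profileSup C₁ C₂ := by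
  have e1 := sq_sqrt (sub_pos.2 h₁).le
  have e2 := sq_sqrt (sub_pos.2 h₂).le
  have a1 := sqrt_pos.2 (sub_pos.2 h₁)
  have a2 := sqrt_pos.2 (sub_pos.2 h₂)
  have := mul_pos a1 a2
  rw [abs_lt, profileSup]
  constructor <;> nlinarith

theorem profileSup_pos : 0 < profileSup C₁ C₂ :=
  (abs_nonneg _).trans_lt (abs_sub_lt_profileSup h₁ h₂)

omit h₁ h₂ in
theorem min_le_profileCos {k τ : ℝ} (hk : 0 ≤ k) (hτ : τ ∈ Icc (0 : ℝ) 1) :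
    min C₁ C₂ ≤ profileCos C₁ C₂ k τ := by
  have a := min_le_left C₁ C₂
  have b := min_le_right C₁ C₂
  have c := mul_nonneg hk (mul_nonneg hτ.1 (sub_nonneg.2 hτ.2))
  unfold profileCos
  nlinarith [mul_le_mul_of_nonneg_left a (sub_nonneg.2 hτ.2), mul_le_mul_of_nonneg_left b hτ.1]

variable (h₁' : -1 < C₁) (h₂' : -1 < C₂)

include h₁' h₂'

omit h₁ h₂ in
theorem neg_one_lt_profileCos {k τ : ℝ} (hk : 0 ≤ k) (hτ : τ ∈ Icc (0 : ℝ) 1) :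
    -1 < profileCos C₁ C₂ k τ := (lt_min h₁' h₂').trans_le (min_le_profileCos hk hτ)

theorem one_sub_profileCos_sq_pos {k τ : ℝ} (hk : k ∈ Ico 0 (profileSup C₁ C₂))
    (hτ : τ ∈ Icc (0 : ℝ) 1) : 0 < 1 - profileCos C₁ C₂ k τ ^ 2 := by
  have a := profileCos_lt_one h₁ h₂ hk.2 hτ
  have b := neg_one_lt_profileCos h₁' h₂' hk.1 hτ
  nlinarith

theorem profileSin_pos {k τ : ℝ} (hk : k ∈ Ico 0 (profileSup C₁ C₂)) (hτ : τ ∈ Icc (0 : ℝ) 1) :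
    0 < profileSin C₁ C₂ k τ :=
  sqrt_pos.2 (one_sub_profileCos_sq_pos h₁ h₂ h₁' h₂' hk hτ)

omit h₁ h₂ h₁' h₂' in
theorem continuous_profileCos (k : ℝ) : Continuous (profileCos C₁ C₂ k) := by
  unfold profileCos; fun_prop

omit h₁ h₂ h₁' h₂' in
theorem continuous_profileSin (k : ℝ) : Continuous (profileSin C₁ C₂ k) := by
  unfold profileSin profileCos; fun_prop

theorem continuousOn_profile {k : ℝ} (hk : k ∈ Ico 0 (profileSup C₁ C₂)) :
    ContinuousOn (fun τ => profileCos C₁ C₂ k τ / profileSin C₁ C₂ k τ) (Icc 0 1) :=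
  (continuous_profileCos k).continuousOn.div (continuous_profileSin k).continuousOn
    fun _ hτ => (profileSin_pos h₁ h₂ h₁' h₂' hk hτ).ne'

theorem continuousOn_profileInt : ContinuousOn (profileInt C₁ C₂) (Ico 0 (profileSup C₁ C₂)) := by
  rw [continuousOn_iff_continuous_domRestrict]
  -- The integrand is controlled only on `[0, 1]`; clamping `τ` makes it continuous for all `τ`
  -- without changing the integral.
  set cl : ℝ → ℝ := fun τ => max 0 (min 1 τ) with hcl
  have hcl' : ∀ τ, cl τ ∈ Icc (0 : ℝ) 1 :=
    fun τ => ⟨le_max_left _ _, max_le zero_le_one (min_le_left _ _)⟩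
  have hclc : Continuous cl := by fun_prop
  have key : Continuous fun k : Ico 0 (profileSup C₁ C₂) => ∫ τ in (0 : ℝ)..1,
      profileCos C₁ C₂ k (cl τ) / profileSin C₁ C₂ k (cl τ) := by
    refine intervalIntegral.continuous_parametric_intervalIntegral_of_continuous ?_
      continuous_const
    refine Continuous.div ?_ ?_ fun p => (profileSin_pos h₁ h₂ h₁' h₂' p.1.2 (hcl' p.2)).ne'
    · simp only [profileCos]; fun_prop
    · simp only [profileSin, profileCos]; fun_prop
  refine key.congr fun k => ?_
  simp only [domRestrict_apply, profileInt]
  refine intervalIntegral.integral_congr fun τ hτ => ?_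
  rw [uIcc_of_le zero_le_one] at hτ
  have : cl τ = τ := by simp [hcl, hτ.1, hτ.2]
  simp only [this]

/-- For `k = 0` the cosine is affine in `τ`, so the integrand times `C₂ - C₁` is the derivative of
`-profileSin`. Keeping the factor on the left includes `C₁ = C₂`. This gives the limit volume `0`
for vanishing drop. -/
theorem sub_mul_profileInt_zero :
    (C₂ - C₁) * profileInt C₁ C₂ 0 = √(1 - C₁ ^ 2) - √(1 - C₂ ^ 2) := by
  have hk : (0 : ℝ) ∈ Ico 0 (profileSup C₁ C₂) := ⟨le_rfl, profileSup_pos h₁ h₂⟩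
  have hd : ∀ τ ∈ Icc (0 : ℝ) 1, HasDerivAt (fun τ => -profileSin C₁ C₂ 0 τ)
      ((C₂ - C₁) * (profileCos C₁ C₂ 0 τ / profileSin C₁ C₂ 0 τ)) τ := by
    intro τ hτ
    have hp := one_sub_profileCos_sq_pos h₁ h₂ h₁' h₂' hk hτ
    have hp' := profileSin_pos h₁ h₂ h₁' h₂' hk hτ
    have e1 : HasDerivAt (profileCos C₁ C₂ 0) (C₂ - C₁) τ := by
      have e2 : profileCos C₁ C₂ 0 = fun τ => C₁ + (C₂ - C₁) * τ := by
        ext t; unfold profileCos; ring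
      rw [e2]
      simpa using ((hasDerivAt_id τ).const_mul (C₂ - C₁)).const_add C₁
    refine ((((e1.pow 2).const_sub 1).sqrt hp.ne').neg).congr_deriv ?_
    have e3 : √(1 - (profileCos C₁ C₂ 0 ^ 2) τ) = profileSin C₁ C₂ 0 τ := rfl
    rw [e3]
    field_simp
    push_cast
    ring
  have h := intervalIntegral.integral_eq_sub_of_hasDerivAt_of_le zero_le_one
    (continuous_profileSin (C₁ := C₁) (C₂ := C₂) 0).neg.continuousOn
    (fun τ hτ => hd τ (Ioo_subset_Icc_self hτ))
    (((continuousOn_profile h₁ h₂ h₁' h₂' hk).const_smul (C₂ - C₁)).intervalIntegrable_of_Icc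
      zero_le_one)
  rw [intervalIntegral.integral_const_mul] at h
  rw [profileInt, h]
  simp [profileSin, profileCos]
  ring

/-- Write `c/q = 1/q - (1 - c)/q` with `c` the cosine and `q` the sine of the profile. The
subtracted term is `√((1 - c)/(1 + c))`, bounded because `c ≥ min C₁ C₂ > -1`. Near the peak `p`,
`q` is at most `2 (a|τ - p| + e)` with `e² = profileSup - k`, and integrating the reciprocal over
`[p, 1]` gives a logarithm of `1/e`. -/
theorem log_le_profileInt {k : ℝ} (hk : k ∈ Ico 0 (profileSup C₁ C₂)) :
    (log √(1 - C₂) - log √(profileSup C₁ C₂ - k)) / (2 * (√(1 - C₁) + √(1 - C₂))) -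
      2 / (1 + min C₁ C₂) ≤ profileInt C₁ C₂ k := by
  set a := √(1 - C₁) + √(1 - C₂) with ha
  set p := profilePeak C₁ C₂ with hp
  set e := √(profileSup C₁ C₂ - k) with he
  set K := 2 / (1 + min C₁ C₂) with hK
  have ha0 : 0 < a := sum_sqrt_pos h₁ h₂
  have hpm : p ∈ Ioo 0 1 := profilePeak_mem h₁ h₂
  have he0 : 0 < e := sqrt_pos.2 (sub_pos.2 hk.2)
  have hee : e ^ 2 = profileSup C₁ C₂ - k := sq_sqrt (sub_pos.2 hk.2).le
  have hm : 0 < 1 + min C₁ C₂ := by linarith [lt_min h₁' h₂']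
  have hm2 : 1 + min C₁ C₂ < 2 := by linarith [min_le_left C₁ C₂]
  have hap : a * (1 - p) = √(1 - C₂) := by
    rw [hp, profilePeak, ← ha]; field_simp; rw [ha]; ring
  have hlow : ∀ τ ∈ Icc (0 : ℝ) 1, 1 / (2 * (a * |τ - p| + e)) ≤
      profileCos C₁ C₂ k τ / profileSin C₁ C₂ k τ + K := by
    intro τ hτ
    have hs := profileSin_pos h₁ h₂ h₁' h₂' hk hτ
    have hs2 : profileSin C₁ C₂ k τ ^ 2 = 1 - profileCos C₁ C₂ k τ ^ 2 :=
      sq_sqrt (one_sub_profileCos_sq_pos h₁ h₂ h₁' h₂' hk hτ).le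
    have hc1 := profileCos_lt_one h₁ h₂ hk.2 hτ
    have hc2 := min_le_profileCos (C₁ := C₁) (C₂ := C₂) hk.1 hτ
    have hone := one_sub_profileCos' h₁ h₂ k τ
    rw [← hee] at hone
    set c := profileCos C₁ C₂ k τ
    set q := profileSin C₁ C₂ k τ
    have hd : 0 ≤ a * |τ - p| := by positivity
    have hττ : τ * (1 - τ) ≤ 1 := by nlinarith [sq_nonneg τ, hτ.1, hτ.2]
    have hone' : 1 - c ≤ (a * |τ - p| + e) ^ 2 := by
      have : profileSup C₁ C₂ * (τ - p) ^ 2 = (a * |τ - p|) ^ 2 := by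
        rw [mul_pow, sq_abs]; rfl
      rw [hone, this]
      nlinarith [mul_le_mul_of_nonneg_left hττ (sq_nonneg e), mul_nonneg hd he0.le]
    have hq : q ≤ 2 * (a * |τ - p| + e) := by
      refine le_of_sq_le_sq ?_ (by positivity)
      nlinarith
    have hK' : 1 - c ≤ K * q := by
      refine le_of_sq_le_sq ?_ (by positivity)
      have h4 : K * (1 + min C₁ C₂) = 2 := by rw [hK]; field_simp
      have hK1 : 1 ≤ K := by rw [hK, le_div_iff₀ hm]; linarith
      have h5 : 1 - c ≤ K ^ 2 * (1 + c) := by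
        have : 2 ≤ K * (1 + c) := by nlinarith
        nlinarith
      rw [mul_pow, hs2]
      nlinarith
    have h6 : 1 / (2 * (a * |τ - p| + e)) ≤ 1 / q := one_div_le_one_div_of_le hs hq
    have h7 : 1 / q ≤ c / q + K := by
      rw [div_add' _ _ _ hs.ne']
      exact div_le_div_of_nonneg_right (by linarith) hs.le
    exact h6.trans h7
  have hcont := continuousOn_profile h₁ h₂ h₁' h₂' hk
  have hint : IntervalIntegrable (fun τ => profileCos C₁ C₂ k τ / profileSin C₁ C₂ k τ) volume 0 1 :=
    hcont.intervalIntegrable_of_Icc zero_le_one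
  have hsum : ∫ τ in (0 : ℝ)..1, (profileCos C₁ C₂ k τ / profileSin C₁ C₂ k τ + K) =
      profileInt C₁ C₂ k + K := by
    rw [intervalIntegral.integral_add hint intervalIntegrable_const]
    simp [profileInt]
  have hmono : ∫ τ in p..1, (profileCos C₁ C₂ k τ / profileSin C₁ C₂ k τ + K) ≤
      ∫ τ in (0 : ℝ)..1, (profileCos C₁ C₂ k τ / profileSin C₁ C₂ k τ + K) := by
    refine intervalIntegral.integral_mono_interval hpm.1.le hpm.2.le le_rfl ?_
      (hint.add intervalIntegrable_const)
    refine (ae_restrict_mem measurableSet_Ioc).mono fun τ hτ => ?_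
    exact le_trans (by positivity) (hlow τ (Ioc_subset_Icc_self hτ))
  have hlog : ∫ τ in p..1, 1 / (2 * (a * (τ - p) + e)) =
      (log (a * (1 - p) + e) - log e) / (2 * a) := by
    rw [intervalIntegral.integral_eq_sub_of_hasDerivAt_of_le hpm.2.le
      (f := fun τ => log (a * (τ - p) + e) / (2 * a))]
    · simp; ring
    · refine ContinuousOn.div_const (ContinuousOn.log (by fun_prop) fun τ hτ => ?_) _
      have := mul_nonneg ha0.le (sub_nonneg.2 hτ.1)
      positivity
    · intro τ hτ
      have hpos := mul_pos ha0 (sub_pos.2 hτ.1)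
      have h1 : HasDerivAt (fun τ => a * (τ - p) + e) a τ := by
        simpa using (((hasDerivAt_id τ).sub_const p).const_mul a).add_const e
      refine ((h1.log (by positivity)).div_const (2 * a)).congr_deriv ?_
      field_simp
    · refine ContinuousOn.intervalIntegrable_of_Icc hpm.2.le ?_
      refine ContinuousOn.div (by fun_prop) (by fun_prop) fun τ hτ => ?_
      have := mul_nonneg ha0.le (sub_nonneg.2 hτ.1)
      positivity
  have hcomp : ∫ τ in p..1, 1 / (2 * (a * (τ - p) + e)) ≤
      ∫ τ in p..1, (profileCos C₁ C₂ k τ / profileSin C₁ C₂ k τ + K) := by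
    have hsub : Icc p 1 ⊆ Icc (0 : ℝ) 1 := Icc_subset_Icc_left hpm.1.le
    refine intervalIntegral.integral_mono_on hpm.2.le ?_ ?_ fun τ hτ => ?_
    · refine ContinuousOn.intervalIntegrable_of_Icc hpm.2.le ?_
      refine ContinuousOn.div (by fun_prop) (by fun_prop) fun τ hτ => ?_
      have := mul_nonneg ha0.le (sub_nonneg.2 hτ.1)
      positivity
    · exact ((hcont.mono hsub).add continuousOn_const).intervalIntegrable_of_Icc hpm.2.le
    · have := hlow τ (hsub hτ)
      rwa [abs_of_nonneg (sub_nonneg.2 hτ.1)] at this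
  have hmonolog : log √(1 - C₂) ≤ log (a * (1 - p) + e) := by
    rw [hap]
    exact log_le_log (sqrt_pos.2 (sub_pos.2 h₂)) (by linarith)
  have h8 : (log √(1 - C₂) - log e) / (2 * a) ≤ (log (a * (1 - p) + e) - log e) / (2 * a) := by
    gcongr
  linarith

theorem tendsto_profileInt :
    Tendsto (profileInt C₁ C₂) (𝓝[<] (profileSup C₁ C₂)) atTop := by
  have hs := profileSup_pos h₁ h₂
  have ha0 := sum_sqrt_pos h₁ h₂
  have hmem : Ioo 0 (profileSup C₁ C₂) ∈ 𝓝[<] (profileSup C₁ C₂) := Ioo_mem_nhdsLT hs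
  refine tendsto_atTop_mono' _ (eventually_of_mem hmem fun k hk =>
    log_le_profileInt h₁ h₂ h₁' h₂' (Ioo_subset_Ico_self hk)) ?_
  refine tendsto_atTop_add_const_right _ _ (Tendsto.atTop_div_const (by positivity) ?_)
  have h1 : Tendsto (fun k => √(profileSup C₁ C₂ - k)) (𝓝[<] (profileSup C₁ C₂)) (𝓝[>] 0) := by
    refine tendsto_nhdsWithin_iff.2 ⟨?_, eventually_of_mem hmem fun k hk =>
      sqrt_pos.2 (sub_pos.2 hk.2)⟩
    have : Continuous fun k => √(profileSup C₁ C₂ - k) := by fun_prop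
    have h2 := this.tendsto (profileSup C₁ C₂)
    rw [sub_self, sqrt_zero] at h2
    exact h2.mono_left nhdsWithin_le_nhds
  have h3 := tendsto_log_nhdsGT_zero.comp h1
  exact tendsto_atTop_add_const_left _ _ (tendsto_neg_atBot_atTop.comp h3)

end Profile

end Capillary

/-! ### Expressing a given surface through the height difference of its contact points. -/

namespace Capillary

/-- The volume of the fluid as a function of the height difference of the contact points. -/
noncomputable def dropVolume (κ θ₁ θ₂ ψ₁ ψ₂ h : ℝ) : ℝ :=
  ((h * profileInt (cos ψ₁) (cos ψ₂) (κ * h ^ 2 / 2)) ^ 2 * sin θ₁ * sin θ₂ / 2 +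
      h * profileInt (cos ψ₁) (cos ψ₂) (κ * h ^ 2 / 2) * h * cos θ₂ * sin θ₁ -
      h ^ 2 * cos θ₁ * cos θ₂ / 2) / sin (θ₁ + θ₂) -
    (h ^ 2 / 2 + (cos ψ₂ - cos ψ₁) / κ) * profileInt (cos ψ₁) (cos ψ₂) (κ * h ^ 2 / 2) +
    (sin ψ₂ - sin ψ₁) / κ

theorem hasDerivWithinAt_integral_Icc {f : ℝ → ℝ} {a b : ℝ} (hab : a ≤ b)
    (hf : ContinuousOn f (Icc a b)) {x : ℝ} (hx : x ∈ Icc a b) :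
    HasDerivWithinAt (fun u => ∫ t in a..u, f t) (f x) (Icc a b) x := by
  set F := IccExtend hab (domRestrict (Icc a b) f) with hF
  have hFc : Continuous F := (continuousOn_iff_continuous_domRestrict.1 hf).Icc_extend'
  have hFf : ∀ t ∈ Icc a b, F t = f t := fun t ht => IccExtend_of_mem _ _ ht
  have h1 : HasDerivAt (fun u => ∫ t in a..u, F t) (F x) x :=
    (hFc.integral_hasStrictDerivAt a x).hasDerivAt
  have h2 : ∀ u ∈ Icc a b, ∫ t in a..u, f t = ∫ t in a..u, F t := by
    intro u hu
    refine intervalIntegral.integral_congr fun t ht => (hFf t ?_).symm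
    rw [uIcc_of_le hu.1] at ht
    exact ⟨ht.1, ht.2.trans hu.2⟩
  rw [← hFf x hx]
  exact h1.hasDerivWithinAt.congr h2 (h2 x hx)

namespace FreeSurface

variable {g σ J θ₁ θ₂ : ℝ} (S : FreeSurface g σ J θ₁ θ₂)

/-- The height difference of the contact points. -/
noncomputable def drop : ℝ := |S.y 0 - S.y S.L|

theorem curv_eq (s : ℝ) : S.curv s = S.curv 0 - g / σ * (S.y 0 - S.y s) := by
  simp only [curv]; ring

section Negative

variable (hg : 0 < g) (hσ : 0 < σ) (h₁ : psiLeft σ J θ₁ < 0) (h₂ : psiRight σ J θ₂ < 0)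

include hg hσ h₁ h₂

theorem y_lt : S.y S.L < S.y 0 := S.y_strictAnti hg hσ h₁ h₂ S.zero_mem S.L_mem S.L_pos

theorem drop_eq : S.drop = S.y 0 - S.y S.L :=
  abs_of_pos (sub_pos.2 (S.y_lt hg hσ h₁ h₂))

theorem drop_pos : 0 < S.drop := by
  rw [S.drop_eq hg hσ h₁ h₂]; exact sub_pos.2 (S.y_lt hg hσ h₁ h₂)

/-- The energy identity between the two ends, where the curvature drops by `(g/σ) · drop`; its
squares cancel and leave a linear equation for `curv 0`. -/
theorem curv_zero_mul_drop : S.curv 0 * S.drop =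
    cos (S.ψ S.L) - cos (S.ψ 0) + g / σ * S.drop ^ 2 / 2 := by
  have hκ : 0 < g / σ := div_pos hg hσ
  have e := S.energy S.L_mem
  rw [S.curv_eq S.L, ← S.drop_eq hg hσ h₁ h₂] at e
  refine mul_left_cancel₀ hκ.ne' ?_
  linear_combination -e

theorem cos_ψ_eq {s : ℝ} (hs : s ∈ Icc 0 S.L) : cos (S.ψ s) =
    profileCos (cos (S.ψ 0)) (cos (S.ψ S.L)) (g / σ * S.drop ^ 2 / 2)
      ((S.y 0 - S.y s) / S.drop) := by
  have hκ : 0 < g / σ := div_pos hg hσ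
  have hd := S.drop_pos hg hσ h₁ h₂
  have e := S.energy hs
  have e' := S.curv_zero_mul_drop hg hσ h₁ h₂
  set τ := (S.y 0 - S.y s) / S.drop with hτ
  have hτ' : S.y 0 - S.y s = S.drop * τ := by rw [hτ]; field_simp
  rw [S.curv_eq s, hτ'] at e
  rw [profileCos]
  refine mul_left_cancel₀ hκ.ne' ?_
  linear_combination e + (g / σ * τ) * e'

theorem sin_ψ_eq {s : ℝ} (hs : s ∈ Icc 0 S.L) : sin (S.ψ s) =
    -profileSin (cos (S.ψ 0)) (cos (S.ψ S.L)) (g / σ * S.drop ^ 2 / 2)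
      ((S.y 0 - S.y s) / S.drop) := by
  rw [profileSin, ← S.cos_ψ_eq hg hσ h₁ h₂ hs, eq_neg_iff_add_eq_zero,
    ← neg_eq_iff_add_eq_zero, eq_comm, sqrt_eq_iff_mul_self_eq]
  · linear_combination -sin_sq_add_cos_sq (S.ψ s)
  · nlinarith [cos_sq_le_one (S.ψ s)]
  · linarith [S.sin_ψ_neg hg hσ h₁ h₂ hs]

theorem depth_mem {s : ℝ} (hs : s ∈ Icc 0 S.L) : (S.y 0 - S.y s) / S.drop ∈ Icc (0 : ℝ) 1 := by
  have hd := S.drop_pos hg hσ h₁ h₂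
  have hanti := (S.y_strictAnti hg hσ h₁ h₂).antitoneOn
  have a1 := hanti S.zero_mem hs hs.1
  have a2 := hanti hs S.L_mem hs.2
  refine ⟨div_nonneg (by linarith) hd.le, ?_⟩
  rw [div_le_one hd, S.drop_eq hg hσ h₁ h₂]
  linarith

theorem abs_cos_lt_one {s : ℝ} (hs : s ∈ Icc 0 S.L) :
    -1 < cos (S.ψ s) ∧ cos (S.ψ s) < 1 := by
  have h := S.sin_ψ_neg hg hσ h₁ h₂ hs
  have := sin_sq_add_cos_sq (S.ψ s)
  constructor <;> nlinarith

/-- The curve passes through the depth `profilePeak`, where `cos ψ < 1`; there the square in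
`one_sub_profileCos'` vanishes, which forces the parameter below `profileSup`. -/
theorem param_mem : g / σ * S.drop ^ 2 / 2 ∈
    Ico 0 (profileSup (cos (S.ψ 0)) (cos (S.ψ S.L))) := by
  have hκ : 0 < g / σ := div_pos hg hσ
  have hd := S.drop_pos hg hσ h₁ h₂
  have b1 := (S.abs_cos_lt_one hg hσ h₁ h₂ S.zero_mem).2
  have b2 := (S.abs_cos_lt_one hg hσ h₁ h₂ S.L_mem).2
  refine ⟨by positivity, lt_profileSup_of_profileCos_lt_one b1 b2 ?_⟩
  have hp := profilePeak_mem b1 b2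
  set p := profilePeak (cos (S.ψ 0)) (cos (S.ψ S.L))
  obtain ⟨s, hs, hsp⟩ : ∃ s ∈ Icc 0 S.L, (S.y 0 - S.y s) / S.drop = p := by
    refine intermediate_value_Icc S.L_pos.le
      ((continuousOn_const.sub S.y_cont).div_const _) ⟨?_, ?_⟩
    · simpa using hp.1.le
    · change p ≤ (S.y 0 - S.y S.L) / S.drop
      rw [← S.drop_eq hg hσ h₁ h₂, div_self hd.ne']; exact hp.2.le
  rw [← hsp, ← S.cos_ψ_eq hg hσ h₁ h₂ hs]
  exact (S.abs_cos_lt_one hg hσ h₁ h₂ hs).2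

/-- Integration of `dx/dy = cot ψ`: the defect between `x` and `drop` times the partial profile
integral has zero derivative along the curve. -/
theorem x_sub_eq : S.x S.L - S.x 0 = S.drop *
    profileInt (cos (S.ψ 0)) (cos (S.ψ S.L)) (g / σ * S.drop ^ 2 / 2) := by
  have hd := S.drop_pos hg hσ h₁ h₂
  have b1 := S.abs_cos_lt_one hg hσ h₁ h₂ S.zero_mem
  have b2 := S.abs_cos_lt_one hg hσ h₁ h₂ S.L_mem
  have hk := S.param_mem hg hσ h₁ h₂
  set G : ℝ → ℝ := fun u => ∫ τ in (0 : ℝ)..u,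
    profileCos (cos (S.ψ 0)) (cos (S.ψ S.L)) (g / σ * S.drop ^ 2 / 2) τ /
      profileSin (cos (S.ψ 0)) (cos (S.ψ S.L)) (g / σ * S.drop ^ 2 / 2) τ with hG
  have hconst : ∀ s ∈ Icc 0 S.L,
      HasDerivWithinAt (fun s => S.x s - S.drop * G ((S.y 0 - S.y s) / S.drop)) 0
        (Icc 0 S.L) s := by
    intro s hs
    have h1 : HasDerivWithinAt (fun s => (S.y 0 - S.y s) / S.drop) (-sin (S.ψ s) / S.drop)
        (Icc 0 S.L) s := ((S.y_deriv s hs).const_sub _).div_const _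
    have h2 := HasDerivWithinAt.comp s (hasDerivWithinAt_integral_Icc zero_le_one
      (continuousOn_profile b1.2 b2.2 b1.1 b2.1 hk) (S.depth_mem hg hσ h₁ h₂ hs)) h1
      (fun t ht => S.depth_mem hg hσ h₁ h₂ ht)
    refine ((S.x_deriv s hs).sub (h2.const_mul S.drop)).congr_deriv ?_
    have hne := (S.sin_ψ_neg hg hσ h₁ h₂ hs).ne
    rw [← S.cos_ψ_eq hg hσ h₁ h₂ hs, ← neg_neg (profileSin _ _ _ _),
      ← S.sin_ψ_eq hg hσ h₁ h₂ hs]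
    field_simp
    ring
  have h := eq_left_of_hasDerivWithinAt_zero hconst S.L_mem
  have e0 : G ((S.y 0 - S.y 0) / S.drop) = 0 := by simp [hG]
  have e1 : (S.y 0 - S.y S.L) / S.drop = 1 := by
    rw [← S.drop_eq hg hσ h₁ h₂, div_self hd.ne']
  simp only [e0, e1] at h
  have e2 : G 1 = profileInt (cos (S.ψ 0)) (cos (S.ψ S.L)) (g / σ * S.drop ^ 2 / 2) := rfl
  rw [← e2]
  linarith

theorem sweptArea_sub_eq (hS : 0 < sin (θ₁ + θ₂)) : S.sweptArea S.L - S.sweptArea 0 =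
    dropVolume (g / σ) θ₁ θ₂ (psiLeft σ J θ₁) (psiRight σ J θ₂) S.drop := by
  obtain ⟨r₁, -, hx1, hy1⟩ := S.left_contact
  obtain ⟨r₂, -, hx2, hy2⟩ := S.right_contact
  have hX := S.x_sub_eq hg hσ h₁ h₂
  have ha := S.curv_zero_mul_drop hg hσ h₁ h₂
  have hdrop := S.drop_eq hg hσ h₁ h₂
  have hU : S.P₀ = g * S.y 0 - σ * S.curv 0 := by rw [curv]; field_simp; ring
  rw [dropVolume, ← S.left_angle, ← S.right_angle, ← hX, sweptArea, sweptArea]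
  set I := profileInt (cos (S.ψ 0)) (cos (S.ψ S.L)) (g / σ * S.drop ^ 2 / 2)
  have hUX : (S.drop ^ 2 / 2 + (cos (S.ψ S.L) - cos (S.ψ 0)) / (g / σ)) * I =
      σ / g * S.curv 0 * (S.x S.L - S.x 0) := by
    rw [hX]
    have : S.drop ^ 2 / 2 + (cos (S.ψ S.L) - cos (S.ψ 0)) / (g / σ) =
        σ / g * (S.curv 0 * S.drop) := by
      rw [ha]; field_simp; ring
    rw [this]; ring
  rw [hUX, hU, hdrop, hx1, hx2, hy1, hy2, cos_pi_sub, sin_pi_sub]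
  -- The wall conditions are linear in the distances `r₁, r₂` with determinant `sin (θ₁ + θ₂)`. This
  -- identity expresses the contact terms of the area through horizontal extent and drop alone.
  have key : ∀ c₁ s₁ c₂ s₂ S : ℝ, S = s₁ * c₂ + c₁ * s₂ → S ≠ 0 →
      ((r₂ * c₂ - r₁ * -c₁) ^ 2 * s₁ * s₂ / 2 +
        (r₂ * c₂ - r₁ * -c₁) * (r₁ * s₁ - r₂ * s₂) * c₂ * s₁ -
        (r₁ * s₁ - r₂ * s₂) ^ 2 * c₁ * c₂ / 2) / S =
      r₁ * r₂ * s₁ * c₂ + r₁ ^ 2 * s₁ * c₁ / 2 - r₂ ^ 2 * s₂ * c₂ / 2 := by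
    rintro c₁ s₁ c₂ s₂ S rfl hS
    rw [div_eq_iff hS]
    ring
  rw [key _ _ _ _ _ (sin_add θ₁ θ₂) hS.ne']
  field_simp
  ring

theorem vol_eq (hθ₁ : 0 ≤ θ₁) (hθ₂ : 0 ≤ θ₂) (hθ : θ₁ + θ₂ < π) (hJ : |J| ≤ σ) :
    S.vol = ENNReal.ofReal
      (dropVolume (g / σ) θ₁ θ₂ (psiLeft σ J θ₁) (psiRight σ J θ₂) S.drop) ∧
    0 < dropVolume (g / σ) θ₁ θ₂ (psiLeft σ J θ₁) (psiRight σ J θ₂) S.drop := by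
  have hN : ∀ s ∈ Icc 0 S.L, 0 < S.support s :=
    fun s hs => S.support_pos_of_neg hg hσ h₁ h₂ hθ₁ hθ₂ hθ hs
  obtain ⟨ρ, -, -, h3, h4⟩ := S.exists_polar_graph hN
    (fun s hs => S.y_nonneg_of_neg hg hσ h₁ h₂ hθ₁ hθ₂ hθ hs) hθ₁ hθ₂ hθ hσ hJ
  have hS : 0 < sin (θ₁ + θ₂) := by
    refine sin_pos_of_pos_of_lt_pi ?_ hθ
    unfold psiLeft at h₁; unfold psiRight at h₂; linarith
  rw [← S.sweptArea_sub_eq hg hσ h₁ h₂ hS, ← S.half_integral_support hg hσ, h3, h4]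
  refine ⟨rfl, mul_pos (by norm_num) ?_⟩
  have hc : ContinuousOn S.support (Icc 0 S.L) :=
    fun s hs => (S.support_hasDeriv hs).continuousWithinAt
  exact intervalIntegral.intervalIntegral_pos_of_pos_on
    (hc.intervalIntegrable_of_Icc S.L_pos.le) (fun s hs => hN s (Ioo_subset_Icc_self hs)) S.L_pos

theorem interiorPeak_iff : S.InteriorPeak ↔ 0 < S.curv 0 ∧ S.curv S.L < 0 := by
  have habs : ∀ s ∈ Icc 0 S.L, |S.ψ s| = -S.ψ s := fun s hs =>
    abs_of_neg (S.ψ_neg hg hσ h₁ h₂ hs)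
  constructor
  · rintro ⟨s, hs, hl, hr, -⟩
    have hs' := Ioo_subset_Icc_self hs
    rw [habs s hs', habs 0 S.zero_mem] at hl
    rw [habs s hs', habs _ S.L_mem] at hr
    constructor
    · by_contra! h
      have := S.ψ_strictAntiOn hg hσ h₁ h₂ S.zero_mem h S.zero_mem hs' hs.1
      linarith
    · by_contra! h
      have := S.ψ_strictMonoOn hg hσ h₁ h₂ S.L_mem h hs' S.L_mem hs.2
      linarith
  · rintro ⟨hl, hr⟩
    obtain ⟨m, hm, hm0⟩ : ∃ m ∈ Icc 0 S.L, S.curv m = 0 :=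
      intermediate_value_Icc' S.L_pos.le S.curv_cont ⟨hr.le, hl.le⟩
    have hmono := S.ψ_strictMonoOn hg hσ h₁ h₂ hm hm0.ge
    have hanti := S.ψ_strictAntiOn hg hσ h₁ h₂ hm hm0.le
    have h0 : 0 < m := lt_of_le_of_ne hm.1 (by rintro rfl; linarith)
    have hL : m < S.L := lt_of_le_of_ne hm.2 (by rintro rfl; linarith)
    refine ⟨m, ⟨h0, hL⟩, ?_, ?_, fun t ht => ?_⟩
    · rw [habs m hm, habs 0 S.zero_mem]
      linarith [hmono (left_mem_Icc.2 h0.le) (right_mem_Icc.2 h0.le) h0]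
    · rw [habs m hm, habs _ S.L_mem]
      linarith [hanti (left_mem_Icc.2 hL.le) (right_mem_Icc.2 hL.le) hL]
    · simp only [mem_ofPred_eq, habs m hm, habs t ht]
      rcases le_total t m with h | h
      · linarith [hmono.monotoneOn ⟨ht.1, h⟩ (right_mem_Icc.2 h0.le) h]
      · linarith [hanti.antitoneOn (left_mem_Icc.2 hL.le) ⟨h, ht.2⟩ h]

theorem boundaryPeak_iff : S.BoundaryPeak ↔ ¬S.InteriorPeak := by
  have habs : ∀ s ∈ Icc 0 S.L, |S.ψ s| = -S.ψ s := fun s hs =>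
    abs_of_neg (S.ψ_neg hg hσ h₁ h₂ hs)
  constructor
  · rintro hB ⟨s, hs, hl, hr, -⟩
    rcases hB with h | h
    · exact (h (Ioo_subset_Icc_self hs)).not_gt hl
    · exact (h (Ioo_subset_Icc_self hs)).not_gt hr
  · rw [S.interiorPeak_iff hg hσ h₁ h₂, not_and_or, not_lt, not_lt]
    rintro (h | h)
    · refine Or.inl fun t ht => ?_
      simp only [mem_ofPred_eq, habs 0 S.zero_mem, habs t ht]
      linarith [(S.ψ_strictAntiOn hg hσ h₁ h₂ S.zero_mem h).antitoneOn S.zero_mem ht ht.1]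
    · refine Or.inr fun t ht => ?_
      simp only [mem_ofPred_eq, habs _ S.L_mem, habs t ht]
      linarith [(S.ψ_strictMonoOn hg hσ h₁ h₂ S.L_mem h).monotoneOn ht S.L_mem ht.2]

theorem curv_L_mul_drop : S.curv S.L * S.drop =
    cos (S.ψ S.L) - cos (S.ψ 0) - g / σ * S.drop ^ 2 / 2 := by
  have h := S.curv_zero_mul_drop hg hσ h₁ h₂
  rw [S.curv_eq S.L, ← S.drop_eq hg hσ h₁ h₂]
  linear_combination h

/-- The decreasing curvature must change sign strictly inside. Multiplied by the drop, its end
values are `cos ψ₂ - cos ψ₁ ± k`, with `k` the right-hand side. -/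
theorem interiorPeak_iff_lt : S.InteriorPeak ↔
    |cos (psiRight σ J θ₂) - cos (psiLeft σ J θ₁)| < g / σ * S.drop ^ 2 / 2 := by
  have hd := S.drop_pos hg hσ h₁ h₂
  have hneg : S.curv S.L < 0 ↔ S.curv S.L * S.drop < 0 :=
    ⟨fun h => mul_neg_of_neg_of_pos h hd, fun h => neg_of_mul_neg_left h hd.le⟩
  rw [S.interiorPeak_iff hg hσ h₁ h₂, abs_lt, ← mul_pos_iff_of_pos_right hd,
    S.curv_zero_mul_drop hg hσ h₁ h₂, hneg,
    S.curv_L_mul_drop hg hσ h₁ h₂, S.left_angle, S.right_angle]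
  constructor <;> rintro ⟨a, b⟩ <;> constructor <;> linarith

theorem exists_stationary (h : |cos (psiRight σ J θ₂) - cos (psiLeft σ J θ₁)| ≤
    g / σ * S.drop ^ 2 / 2) :
    ∃ s ∈ Icc 0 S.L, IsMinOn (fun t => |S.ψ t|) (Icc 0 S.L) s ∧ g * S.y s = S.P₀ := by
  have hd := S.drop_pos hg hσ h₁ h₂
  have habs : ∀ s ∈ Icc 0 S.L, |S.ψ s| = -S.ψ s := fun s hs =>
    abs_of_neg (S.ψ_neg hg hσ h₁ h₂ hs)
  have e1 := S.curv_zero_mul_drop hg hσ h₁ h₂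
  have e2 := S.curv_L_mul_drop hg hσ h₁ h₂
  rw [abs_le] at h
  rw [S.left_angle, S.right_angle] at e1 e2
  have hl : 0 ≤ S.curv 0 := by
    refine nonneg_of_mul_nonneg_left (b := S.drop) ?_ hd
    linarith [h.1]
  have hr : S.curv S.L ≤ 0 := by
    refine nonpos_of_mul_nonpos_left (b := S.drop) ?_ hd
    linarith [h.2]
  obtain ⟨m, hm, hm0⟩ : ∃ m ∈ Icc 0 S.L, S.curv m = 0 :=
    intermediate_value_Icc' S.L_pos.le S.curv_cont ⟨hr, hl⟩
  have hmono := S.ψ_strictMonoOn hg hσ h₁ h₂ hm hm0.ge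
  have hanti := S.ψ_strictAntiOn hg hσ h₁ h₂ hm hm0.le
  refine ⟨m, hm, fun t ht => ?_, ?_⟩
  · simp only [mem_ofPred_eq, habs m hm, habs t ht]
    rcases le_total t m with h | h
    · linarith [hmono.monotoneOn ⟨ht.1, h⟩ (right_mem_Icc.2 hm.1) h]
    · linarith [hanti.antitoneOn (left_mem_Icc.2 hm.2) ⟨h, ht.2⟩ h]
  · rw [curv, div_eq_zero_iff] at hm0
    rcases hm0 with h | h
    · linarith
    · exact absurd h hσ.ne'

/-- Heights decrease along the curve, so the heights of the contacts are the extreme heights of the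
point set. This is how different drops are seen to give different point sets. -/
theorem drop_eq_of_trace_eq {T : FreeSurface g σ J θ₁ θ₂} (hT : S.trace = T.trace) :
    S.drop = T.drop := by
  have key : ∀ A B : FreeSurface g σ J θ₁ θ₂, A.trace ⊆ B.trace →
      A.y 0 ≤ B.y 0 ∧ B.y B.L ≤ A.y A.L := by
    intro A B h
    have hB := (B.y_strictAnti hg hσ h₁ h₂).antitoneOn
    constructor
    · obtain ⟨s, hs, he⟩ := h ⟨0, A.zero_mem, rfl⟩
      rw [Prod.mk.injEq] at he
      rw [← he.2]
      exact hB B.zero_mem hs hs.1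
    · obtain ⟨s, hs, he⟩ := h ⟨A.L, A.L_mem, rfl⟩
      rw [Prod.mk.injEq] at he
      rw [← he.2]
      exact hB hs B.L_mem hs.2
  have a := key S T hT.subset
  have b := key T S hT.symm.subset
  rw [S.drop_eq hg hσ h₁ h₂, T.drop_eq hg hσ h₁ h₂]
  linarith [a.1, a.2, b.1, b.2]

end Negative

end FreeSurface

end Capillary

/-! ### Construction of a surface with prescribed height difference. -/

namespace Capillary

section Negative

variable {g σ J θ₁ θ₂ : ℝ} (hg : 0 < g) (hσ : 0 < σ)
  (h₁ : psiLeft σ J θ₁ < 0) (h₂ : psiRight σ J θ₂ < 0)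
  (hθ₁ : 0 ≤ θ₁) (hθ₂ : 0 ≤ θ₂) (hθ : θ₁ + θ₂ < π)

include h₁ h₂

theorem theta_lt : θ₂ < gammaAngle σ J + π / 2 ∧ gammaAngle σ J + π / 2 < θ₁ := by
  unfold psiLeft at h₁; unfold psiRight at h₂
  exact ⟨by linarith, by linarith⟩

include hθ₁ hθ₂ hθ

omit hθ₁ in
theorem abs_cos_psi_lt_one : (-1 < cos (psiLeft σ J θ₁) ∧ cos (psiLeft σ J θ₁) < 1) ∧
    (-1 < cos (psiRight σ J θ₂) ∧ cos (psiRight σ J θ₂) < 1) := by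
  have hθ' := theta_lt h₁ h₂
  have key : ∀ ψ : ℝ, -π < ψ → ψ < 0 → -1 < cos ψ ∧ cos ψ < 1 := by
    intro ψ ha hb
    have h := sin_neg_of_neg_of_neg_pi_lt hb ha
    have := sin_sq_add_cos_sq ψ
    constructor <;> nlinarith
  exact ⟨key _ (by unfold psiLeft; linarith) h₁, key _ (by unfold psiRight; linarith) h₂⟩

omit hθ₁ hθ₂ hθ in
theorem arccos_profileCos_le (hl : -π ≤ psiLeft σ J θ₁) (hr : -π ≤ psiRight σ J θ₂)
    {k τ : ℝ} (hk : 0 ≤ k) (hτ : τ ∈ Icc (0 : ℝ) 1) :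
    arccos (profileCos (cos (psiLeft σ J θ₁)) (cos (psiRight σ J θ₂)) k τ) ≤
      max (-psiLeft σ J θ₁) (-psiRight σ J θ₂) := by
  have h := min_le_profileCos (C₁ := cos (psiLeft σ J θ₁)) (C₂ := cos (psiRight σ J θ₂)) hk hτ
  have key : ∀ ψ : ℝ, -π ≤ ψ → ψ < 0 → arccos (cos ψ) = -ψ := by
    intro ψ ha hb
    rw [← cos_neg, arccos_cos (by linarith) (by linarith)]
  have a1 := key _ hl h₁
  have a2 := key _ hr h₂
  rw [le_max_iff]
  rcases min_le_iff.1 h with h | h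
  · left; rw [← a1]; exact antitone_arccos h
  · right; rw [← a2]; exact antitone_arccos h

include hg hσ

omit hθ₁ in
-- The profile is read backwards: depth gives the slope angle, arc length is the integral of `h/q`,
-- and its inverse parametrizes the curve. The contact distances solve the linear wall conditions by
-- Cramer's rule; what has to be checked is that they are positive.
theorem exists_freeSurface {h : ℝ} (hh : 0 < h) (hk : g / σ * h ^ 2 / 2 <
    profileSup (cos (psiLeft σ J θ₁)) (cos (psiRight σ J θ₂))) :
    ∃ S : FreeSurface g σ J θ₁ θ₂, S.drop = h := by
  have hκ : 0 < g / σ := div_pos hg hσ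
  have hθ' := theta_lt h₁ h₂
  obtain ⟨⟨b1, b1'⟩, b2, b2'⟩ := abs_cos_psi_lt_one h₁ h₂ hθ₂ hθ
  set k := g / σ * h ^ 2 / 2 with hkdef
  have hkm : k ∈ Ico 0 (profileSup (cos (psiLeft σ J θ₁)) (cos (psiRight σ J θ₂))) :=
    ⟨by positivity, hk⟩
  have harc : ∀ τ ∈ Icc (0 : ℝ) 1, arccos (profileCos (cos (psiLeft σ J θ₁))
      (cos (psiRight σ J θ₂)) k τ) ≤ max (-psiLeft σ J θ₁) (-psiRight σ J θ₂) := fun τ hτ =>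
    arccos_profileCos_le h₁ h₂ (by unfold psiLeft; linarith) (by unfold psiRight; linarith)
      hkm.1 hτ
  have hcl := fun τ (hτ : τ ∈ Icc (0 : ℝ) 1) => neg_one_lt_profileCos b1 b2 hkm.1 hτ
  have hcu := fun τ (hτ : τ ∈ Icc (0 : ℝ) 1) => profileCos_lt_one b1' b2' hkm.2 hτ
  have hq := fun τ (hτ : τ ∈ Icc (0 : ℝ) 1) => profileSin_pos b1' b2' b1 b2 hkm hτ
  have hcq := continuousOn_profile b1' b2' b1 b2 hkm
  have hc0 : profileCos (cos (psiLeft σ J θ₁)) (cos (psiRight σ J θ₂)) k 0 =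
      cos (psiLeft σ J θ₁) := by simp [profileCos]
  have hc1 : profileCos (cos (psiLeft σ J θ₁)) (cos (psiRight σ J θ₂)) k 1 =
      cos (psiRight σ J θ₂) := by simp [profileCos]
  have hcd : ∀ τ, HasDerivAt (profileCos (cos (psiLeft σ J θ₁)) (cos (psiRight σ J θ₂)) k)
      (cos (psiRight σ J θ₂) - cos (psiLeft σ J θ₁) + k * (1 - 2 * τ)) τ := by
    intro τ
    have := ((((hasDerivAt_id τ).const_sub 1).mul_const (cos (psiLeft σ J θ₁))).add
      ((hasDerivAt_id τ).mul_const (cos (psiRight σ J θ₂)))).add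
      (((hasDerivAt_id τ).mul ((hasDerivAt_id τ).const_sub 1)).const_mul k)
    refine this.congr_deriv ?_
    simp only [id]; ring
  have hqc : ContinuousOn (profileSin (cos (psiLeft σ J θ₁)) (cos (psiRight σ J θ₂)) k) (Icc 0 1) :=
    (continuous_profileSin k).continuousOn
  have hqdef : ∀ τ, profileSin (cos (psiLeft σ J θ₁)) (cos (psiRight σ J θ₂)) k τ =
    √(1 - profileCos (cos (psiLeft σ J θ₁)) (cos (psiRight σ J θ₂)) k τ ^ 2) := fun _ => rfl
  have hI : profileInt (cos (psiLeft σ J θ₁)) (cos (psiRight σ J θ₂)) k = ∫ τ in (0 : ℝ)..1,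
    profileCos (cos (psiLeft σ J θ₁)) (cos (psiRight σ J θ₂)) k τ /
      profileSin (cos (psiLeft σ J θ₁)) (cos (psiRight σ J θ₂)) k τ := rfl
  generalize profileCos (cos (psiLeft σ J θ₁)) (cos (psiRight σ J θ₂)) k = c at *
  generalize profileSin (cos (psiLeft σ J θ₁)) (cos (psiRight σ J θ₂)) k = q at *
  set I := profileInt (cos (psiLeft σ J θ₁)) (cos (psiRight σ J θ₂)) k
  have h1q : ContinuousOn (fun τ => 1 / q τ) (Icc 0 1) :=
    continuousOn_const.div hqc fun τ hτ => (hq τ hτ).ne'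
  have hci : ∀ a : ℝ, IntervalIntegrable (fun τ => a * (c τ / q τ)) volume 0 1 := fun a =>
    (ContinuousOn.mul continuousOn_const hcq).intervalIntegrable_of_Icc zero_le_one
  have hS : 0 < sin (θ₁ + θ₂) := sin_pos_of_pos_of_lt_pi (by linarith) hθ
  -- the arc length as a function of the depth, and its inverse
  obtain ⟨t, hmaps, -, hleft, -, htd⟩ := exists_inverse_Icc (zero_le_one' ℝ)
    (f := fun u => h * ∫ τ in (0 : ℝ)..u, 1 / q τ) (f' := fun τ => h * (1 / q τ))
    (fun u hu => (hasDerivWithinAt_integral_Icc zero_le_one h1q hu).const_mul h)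
    (fun τ hτ => by have := hq τ (Ioo_subset_Icc_self hτ); positivity)
  simp only [intervalIntegral.integral_same, mul_zero] at hmaps hleft htd
  set L := h * ∫ τ in (0 : ℝ)..1, 1 / q τ with hL
  have hL0 : 0 < L := by
    refine mul_pos hh (intervalIntegral.intervalIntegral_pos_of_pos_on
      (h1q.intervalIntegrable_of_Icc zero_le_one) (fun τ hτ => ?_) one_pos)
    have := hq τ (Ioo_subset_Icc_self hτ)
    positivity
  have ht0 : t 0 = 0 := by
    have := hleft 0 ⟨le_rfl, zero_le_one⟩
    simpa using this
  have ht1 : t L = 1 := hleft 1 ⟨zero_le_one, le_rfl⟩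
  have htd' : ∀ s ∈ Icc 0 L, HasDerivWithinAt t (q (t s) / h) (Icc 0 L) s := by
    intro s hs
    have hp := hq _ (hmaps hs)
    refine (htd s hs (by positivity)).congr_deriv ?_
    field_simp
  -- the distances of the contact points from the vertex
  have hr1 : 0 < (sin θ₂ * (h * I) + cos θ₂ * h) / sin (θ₁ + θ₂) := by
    refine div_pos ?_ hS
    have e : sin θ₂ * (h * I) + cos θ₂ * h =
        h * ∫ τ in (0 : ℝ)..1, (sin θ₂ * (c τ / q τ) + cos θ₂) := by
      rw [intervalIntegral.integral_add (hci _) intervalIntegrable_const, intervalIntegral.integral_const_mul, ← hI]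
      simp; ring
    rw [e]
    refine mul_pos hh (intervalIntegral.intervalIntegral_pos_of_pos_on
      (((continuousOn_const.mul hcq).add continuousOn_const).intervalIntegrable_of_Icc zero_le_one)
      (fun τ hτ' => ?_) one_pos)
    have hτ := Ioo_subset_Icc_self hτ'
    have hp := hq τ hτ
    -- This sine is `q` times the integrand. It is positive because `-ψ₁` and `-ψ₂`, hence all
    -- steepnesses on the profile, are below `π - θ₂`.
    have h5 : 0 < sin (θ₂ + arccos (c τ)) := by
      refine sin_pos_of_pos_of_lt_pi ?_ ?_
      · have := arccos_pos.2 (hcu τ hτ); linarith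
      · have : max (-psiLeft σ J θ₁) (-psiRight σ J θ₂) < π - θ₂ :=
          max_lt (by unfold psiLeft; linarith) (by unfold psiRight; linarith)
        linarith [harc τ hτ]
    rw [sin_add, cos_arccos (hcl τ hτ).le (hcu τ hτ).le, sin_arccos, ← hqdef] at h5
    have e2 : sin θ₂ * (c τ / q τ) + cos θ₂ = (sin θ₂ * c τ + cos θ₂ * q τ) / q τ := by
      field_simp
    rw [e2]; positivity
  have hr2 : 0 < (sin θ₁ * (h * I) - cos θ₁ * h) / sin (θ₁ + θ₂) := by
    refine div_pos ?_ hS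
    have e : sin θ₁ * (h * I) - cos θ₁ * h =
        h * ∫ τ in (0 : ℝ)..1, (sin θ₁ * (c τ / q τ) - cos θ₁) := by
      rw [intervalIntegral.integral_sub (hci _) intervalIntegrable_const, intervalIntegral.integral_const_mul, ← hI]
      simp; ring
    rw [e]
    refine mul_pos hh (intervalIntegral.intervalIntegral_pos_of_pos_on
      (((continuousOn_const.mul hcq).sub continuousOn_const).intervalIntegrable_of_Icc zero_le_one)
      (fun τ hτ' => ?_) one_pos)
    have hτ := Ioo_subset_Icc_self hτ'
    have hp := hq τ hτ
    -- Likewise, all steepnesses on the profile are below `θ₁`, since `-ψ₁` and `-ψ₂` are.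
    have h5 : 0 < sin (θ₁ - arccos (c τ)) := by
      refine sin_pos_of_pos_of_lt_pi ?_ ?_
      · have : max (-psiLeft σ J θ₁) (-psiRight σ J θ₂) < θ₁ :=
          max_lt (by unfold psiLeft; linarith) (by unfold psiRight; linarith)
        linarith [harc τ hτ]
      · have := arccos_nonneg (c τ); linarith
    rw [sin_sub, cos_arccos (hcl τ hτ).le (hcu τ hτ).le, sin_arccos, ← hqdef] at h5
    have e2 : sin θ₁ * (c τ / q τ) - cos θ₁ = (sin θ₁ * c τ - cos θ₁ * q τ) / q τ := by
      field_simp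
    rw [e2]; positivity
  set r₁ := (sin θ₂ * (h * I) + cos θ₂ * h) / sin (θ₁ + θ₂) with hr₁
  set r₂ := (sin θ₁ * (h * I) - cos θ₁ * h) / sin (θ₁ + θ₂) with hr₂
  have ex : -(r₁ * cos θ₁) + h * I = r₂ * cos θ₂ := by
    rw [hr₁, hr₂]
    field_simp
    rw [sin_add]; ring
  have ey : r₁ * sin θ₁ - h = r₂ * sin θ₂ := by
    rw [hr₁, hr₂]
    field_simp
    rw [sin_add]; ring
  have hcos0 : ∀ ψ : ℝ, -π ≤ ψ → ψ ≤ 0 → -arccos (cos ψ) = ψ := by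
    intro ψ ha hb
    rw [← cos_neg, arccos_cos (by linarith) (by linarith)]; ring
  refine ⟨{
    L := L
    -- Chosen so that the curvature at the left contact has the value required by
    -- `curv_zero_mul_drop`.
    P₀ := g * (r₁ * sin θ₁) -
      σ * ((cos (psiRight σ J θ₂) - cos (psiLeft σ J θ₁)) / h + k / h)
    x := fun s => -(r₁ * cos θ₁) + h * ∫ τ in (0 : ℝ)..(t s), c τ / q τ
    y := fun s => r₁ * sin θ₁ - h * t s
    ψ := fun s => -arccos (c (t s))
    L_pos := hL0
    x_deriv := fun s hs => ?_
    y_deriv := fun s hs => ?_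
    ψ_deriv := fun s hs => ?_
    ψ_range := fun s hs => ?_
    left_contact := ⟨r₁, hr1, ?_, ?_⟩
    right_contact := ⟨r₂, hr2, ?_, ?_⟩
    left_angle := ?_
    right_angle := ?_ }, ?_⟩
  · have h3 := HasDerivWithinAt.comp s (hasDerivWithinAt_integral_Icc zero_le_one hcq (hmaps hs))
      (htd' s hs) hmaps
    refine ((h3.const_mul h).const_add _).congr_deriv ?_
    rw [cos_neg, cos_arccos (hcl _ (hmaps hs)).le (hcu _ (hmaps hs)).le]
    have := hq _ (hmaps hs)
    field_simp
  · refine (((htd' s hs).const_mul h).const_sub _).congr_deriv ?_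
    rw [sin_neg, sin_arccos, ← hqdef]
    field_simp
  · have h3 := HasDerivWithinAt.comp s ((hasDerivAt_arccos (hcl _ (hmaps hs)).ne'
      (hcu _ (hmaps hs)).ne).comp (t s) (hcd (t s))).hasDerivWithinAt (htd' s hs) hmaps
    refine h3.neg.congr_deriv ?_
    rw [← hqdef]
    have := hq _ (hmaps hs)
    rw [hkdef]
    field_simp
    ring
  · have h3 : max (-psiLeft σ J θ₁) (-psiRight σ J θ₂) < π :=
      max_lt (by unfold psiLeft; linarith) (by unfold psiRight; linarith)
    exact ⟨by linarith [harc _ (hmaps hs)], by linarith [arccos_nonneg (c (t s)), pi_pos]⟩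
  · simp [ht0, cos_pi_sub]
  · simp [ht0, sin_pi_sub]
  · simp only [ht1, ← hI, ex]
  · simp only [ht1, mul_one, ey]
  · simp only [ht0, hc0]
    exact hcos0 _ (by unfold psiLeft; linarith) h₁.le
  · simp only [ht1, hc1]
    exact hcos0 _ (by unfold psiRight; linarith) h₂.le
  · simp only [FreeSurface.drop, ht0, ht1]
    simp [abs_of_pos hh]

end Negative

end Capillary

/-! ### Invariance under reflection, and the volume as a function of the drop. -/

namespace Capillary

namespace FreeSurface

variable {g σ J θ₁ θ₂ : ℝ} (S : FreeSurface g σ J θ₁ θ₂)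

theorem mirror_ψ (s : ℝ) : S.mirror.ψ s = -S.ψ (S.L - s) := rfl
theorem mirror_L : S.mirror.L = S.L := rfl

theorem mirror_drop : S.mirror.drop = S.drop := by
  simp [drop, mirror, abs_sub_comm]

theorem mirror_vol : S.mirror.vol = S.vol := by
  have hpre : S.mirror.region = (fun p : ℝ × ℝ => (-p.1, p.2)) ⁻¹' S.region := by
    ext p
    constructor
    · rintro ⟨s, hs, t, ht, rfl⟩
      exact ⟨S.L - s, S.reflect_mem hs, t, ht, by simp [mirror]⟩
    · rintro ⟨s, hs, t, ht, he⟩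
      rw [Prod.mk.injEq] at he
      refine ⟨S.L - s, S.reflect_mem hs, t, ht, ?_⟩
      ext
      · simp [mirror, ← he.1]
      · simp [mirror, ← he.2]
  have hmp : MeasurePreserving (fun p : ℝ × ℝ => (-p.1, p.2)) volume volume :=
    (Measure.measurePreserving_neg (volume : Measure ℝ)).prod (MeasurePreserving.id volume)
  rw [vol, hpre, hmp.measure_preimage S.measurableSet_region.nullMeasurableSet, vol]

theorem isMinOn_mirror {s : ℝ} (h : IsMinOn (fun t => |S.ψ t|) (Icc 0 S.L) s) :
    IsMinOn (fun t => |S.mirror.ψ t|) (Icc 0 S.mirror.L) (S.L - s) := by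
  intro t ht
  have := h (S.reflect_mem ht)
  simpa [mirror_ψ] using this

theorem InteriorPeak.mirror {S : FreeSurface g σ J θ₁ θ₂} (h : S.InteriorPeak) :
    S.mirror.InteriorPeak := by
  obtain ⟨s, hs, h1, h2, h3⟩ := h
  refine ⟨S.L - s, ⟨by linarith [hs.2], ?_⟩, ?_, ?_, S.isMinOn_mirror h3⟩
  · rw [mirror_L]; linarith [hs.1]
  · simpa [mirror_ψ] using h2
  · simpa [mirror_ψ, mirror_L] using h1

theorem BoundaryPeak.mirror {S : FreeSurface g σ J θ₁ θ₂} (h : S.BoundaryPeak) :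
    S.mirror.BoundaryPeak := by
  rcases h with h | h
  · exact Or.inr (by simpa [mirror_L] using S.isMinOn_mirror h)
  · exact Or.inl (by simpa using S.isMinOn_mirror h)

theorem isMinOn_of_mirror {s : ℝ}
    (h : IsMinOn (fun t => |S.mirror.ψ t|) (Icc 0 S.mirror.L) s) :
    IsMinOn (fun t => |S.ψ t|) (Icc 0 S.L) (S.L - s) := by
  intro t ht
  have := h (S.reflect_mem ht)
  simpa [mirror_ψ] using this

theorem interiorPeak_of_mirror (h : S.mirror.InteriorPeak) : S.InteriorPeak := by
  obtain ⟨s, hs, h1, h2, h3⟩ := h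
  have hs2 : s < S.L := hs.2
  refine ⟨S.L - s, ⟨by linarith, by linarith [hs.1]⟩, ?_, ?_, S.isMinOn_of_mirror h3⟩
  · simpa [mirror_ψ, mirror_L] using h2
  · simpa [mirror_ψ] using h1

theorem boundaryPeak_of_mirror (h : S.mirror.BoundaryPeak) : S.BoundaryPeak := by
  rcases h with h | h
  · exact Or.inr (by simpa using S.isMinOn_of_mirror h)
  · exact Or.inl (by simpa [mirror_L] using S.isMinOn_of_mirror h)

theorem mirror_trace : S.mirror.trace = (fun p : ℝ × ℝ => (-p.1, p.2)) '' S.trace := by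
  ext p
  constructor
  · rintro ⟨s, hs, rfl⟩
    exact ⟨_, ⟨S.L - s, S.reflect_mem hs, rfl⟩, rfl⟩
  · rintro ⟨_, ⟨s, hs, rfl⟩, rfl⟩
    exact ⟨S.L - s, S.reflect_mem hs, by simp [mirror]⟩

end FreeSurface

/-- The free surfaces are parametrized by the height difference `h ∈ (0, hₘ)` of their contact
points; their volume `V h` is continuous, vanishes at `0` and is unbounded at `hₘ`, and the slope
angle has an interior extremum exactly for `h > h₀`. -/
def HasVolumeCurve (g σ J θ₁ θ₂ : ℝ) : Prop :=
  ∃ (V : ℝ → ℝ) (h₀ hₘ : ℝ), 0 ≤ h₀ ∧ h₀ < hₘ ∧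
    (h₀ = 0 → psiLeft σ J θ₁ = psiRight σ J θ₂) ∧
    ContinuousOn V (Ico 0 hₘ) ∧ V 0 = 0 ∧ (∀ h ∈ Ioo 0 hₘ, 0 < V h) ∧
    Tendsto V (𝓝[<] hₘ) atTop ∧
    (∀ S : FreeSurface g σ J θ₁ θ₂, S.drop ∈ Ioo 0 hₘ ∧ S.vol = ENNReal.ofReal (V S.drop) ∧
      (S.InteriorPeak ↔ h₀ < S.drop) ∧ (S.BoundaryPeak ↔ S.drop ≤ h₀) ∧
      (h₀ ≤ S.drop →
        ∃ s ∈ Icc 0 S.L, IsMinOn (fun t => |S.ψ t|) (Icc 0 S.L) s ∧ g * S.y s = S.P₀)) ∧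
    (∀ h ∈ Ioo 0 hₘ, ∃ S : FreeSurface g σ J θ₁ θ₂, S.drop = h) ∧
    (∀ S T : FreeSurface g σ J θ₁ θ₂, S.trace = T.trace → S.drop = T.drop)

theorem HasVolumeCurve.mirror {g σ J θ₁ θ₂ : ℝ} (H : HasVolumeCurve g σ J θ₂ θ₁) :
    HasVolumeCurve g σ J θ₁ θ₂ := by
  obtain ⟨V, h₀, hₘ, a1, a2, a3, a4, a5, a6, a7, hS, hex, htr⟩ := H
  refine ⟨V, h₀, hₘ, a1, a2, fun h => ?_, a4, a5, a6, a7, fun S => ?_, fun h hh => ?_,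
    fun S T h => ?_⟩
  · have := a3 h
    rw [psiLeft_swap σ J θ₂, psiRight_swap σ J θ₁] at this
    linarith
  · have h1 := hS S.mirror
    rw [S.mirror_drop, S.mirror_vol] at h1
    refine ⟨h1.1, h1.2.1, ?_, ?_, fun h => ?_⟩
    · rw [← h1.2.2.1]
      exact ⟨fun h => h.mirror, S.interiorPeak_of_mirror⟩
    · rw [← h1.2.2.2.1]
      exact ⟨fun h => h.mirror, S.boundaryPeak_of_mirror⟩
    · obtain ⟨s, hs, hmin, he⟩ := h1.2.2.2.2 h
      exact ⟨S.L - s, S.reflect_mem hs, S.isMinOn_of_mirror hmin, he⟩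
  · obtain ⟨S, hd⟩ := hex h hh
    exact ⟨S.mirror, by rw [S.mirror_drop, hd]⟩
  · have := htr S.mirror T.mirror (by rw [S.mirror_trace, T.mirror_trace, h])
    rwa [S.mirror_drop, T.mirror_drop] at this

section Negative

variable {g σ J θ₁ θ₂ : ℝ} (hg : 0 < g) (hσ : 0 < σ)
  (h₁ : psiLeft σ J θ₁ < 0) (h₂ : psiRight σ J θ₂ < 0)
  (hθ₁ : 0 ≤ θ₁) (hθ₂ : 0 ≤ θ₂) (hθ : θ₁ + θ₂ < π)

include hg hσ h₁ h₂ hθ₁ hθ₂ hθ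

theorem hasVolumeCurve_of_neg (hJ : |J| ≤ σ) : HasVolumeCurve g σ J θ₁ θ₂ := by
  have hκ : 0 < g / σ := div_pos hg hσ
  have hθ' := theta_lt h₁ h₂
  obtain ⟨⟨b1, b1'⟩, b2, b2'⟩ := abs_cos_psi_lt_one h₁ h₂ hθ₂ hθ
  have hl : -π < psiLeft σ J θ₁ := by unfold psiLeft; linarith
  have hr : -π < psiRight σ J θ₂ := by unfold psiRight; linarith
  have hsup := profileSup_pos b1' b2'
  have habs := abs_sub_lt_profileSup b1' b2'
  have hIc := continuousOn_profileInt b1' b2' b1 b2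
  have hIlim := tendsto_profileInt b1' b2' b1 b2
  have hI0 := sub_mul_profileInt_zero b1' b2' b1 b2
  have hmemS : ∀ S : FreeSurface g σ J θ₁ θ₂, g / σ * S.drop ^ 2 / 2 <
      profileSup (cos (psiLeft σ J θ₁)) (cos (psiRight σ J θ₂)) := fun S => by
    have := (S.param_mem hg hσ h₁ h₂).2
    rwa [S.left_angle, S.right_angle] at this
  have hex : ∀ h : ℝ, 0 < h → g / σ * h ^ 2 / 2 <
      profileSup (cos (psiLeft σ J θ₁)) (cos (psiRight σ J θ₂)) →
      ∃ S : FreeSurface g σ J θ₁ θ₂, S.drop = h :=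
    fun h hh hk => exists_freeSurface hg hσ h₁ h₂ hθ₂ hθ hh hk
  set K := profileSup (cos (psiLeft σ J θ₁)) (cos (psiRight σ J θ₂)) with hK
  set D := |cos (psiRight σ J θ₂) - cos (psiLeft σ J θ₁)| with hD
  have hiff : ∀ {h A : ℝ}, 0 < h → (√(2 * A / (g / σ)) < h ↔ A < g / σ * h ^ 2 / 2) := by
    intro h A hh
    rw [sqrt_lt' hh, div_lt_iff₀ hκ]
    constructor <;> intro h <;> linarith
  have hiff' : ∀ {h A : ℝ}, 0 ≤ h → (h < √(2 * A / (g / σ)) ↔ g / σ * h ^ 2 / 2 < A) := by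
    intro h A hh
    rw [lt_sqrt hh, lt_div_iff₀ hκ]
    constructor <;> intro h <;> linarith
  -- The drop at which the parameter reaches `profileSup`; likewise `h₀` below is the drop at which
  -- it reaches `D`.
  set hm := √(2 * K / (g / σ)) with hhm
  have hm0 : 0 < hm := sqrt_pos.2 (by positivity)
  have hmK : g / σ * hm ^ 2 / 2 = K := by
    rw [hhm, sq_sqrt (by positivity)]; field_simp
  have hkm : MapsTo (fun h => g / σ * h ^ 2 / 2) (Ico 0 hm) (Ico 0 K) :=
    fun h hh => ⟨by positivity, (hiff' hh.1).1 hh.2⟩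
  have hvol : ∀ S : FreeSurface g σ J θ₁ θ₂, _ := fun S =>
    S.vol_eq hg hσ h₁ h₂ hθ₁ hθ₂ hθ hJ
  have hint : ∀ S : FreeSurface g σ J θ₁ θ₂, S.InteriorPeak ↔ √(2 * D / (g / σ)) < S.drop := by
    intro S
    rw [S.interiorPeak_iff_lt hg hσ h₁ h₂, hiff (S.drop_pos hg hσ h₁ h₂)]
  have hS : 0 < sin (θ₁ + θ₂) := sin_pos_of_pos_of_lt_pi (by linarith) hθ
  have hs1 : 0 < sin θ₁ := sin_pos_of_pos_of_lt_pi (by linarith) (by linarith)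
  set V := dropVolume (g / σ) θ₁ θ₂ (psiLeft σ J θ₁) (psiRight σ J θ₂) with hV
  set I : ℝ → ℝ := fun h =>
    profileInt (cos (psiLeft σ J θ₁)) (cos (psiRight σ J θ₂)) (g / σ * h ^ 2 / 2) with hI
  have hIcont : ContinuousOn I (Ico 0 hm) := hIc.comp (by fun_prop) hkm
  have hIt : Tendsto I (𝓝[<] hm) atTop := by
    refine hIlim.comp (tendsto_nhdsWithin_iff.2 ⟨?_, eventually_of_mem (Ioo_mem_nhdsLT hm0)
      fun h hh => (hkm ⟨hh.1.le, hh.2⟩).2⟩)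
    have hc : Continuous fun h : ℝ => g / σ * h ^ 2 / 2 := by fun_prop
    have := hc.tendsto hm
    rw [hmK] at this
    exact this.mono_left nhdsWithin_le_nhds
  refine ⟨V, √(2 * D / (g / σ)), hm, sqrt_nonneg _, ?_, ?_, ?_, ?_, ?_, ?_, ?_, ?_, ?_⟩
  · exact sqrt_lt_sqrt (by positivity) (by gcongr)
  · intro h
    rw [sqrt_eq_zero (by positivity)] at h
    have hD0 : D = 0 := by
      rw [div_eq_zero_iff] at h
      rcases h with h | h
      · linarith
      · exact absurd h hκ.ne'
    have he := sub_eq_zero.1 (abs_eq_zero.1 hD0)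
    rw [← cos_neg, ← cos_neg (psiLeft σ J θ₁)] at he
    have := injOn_cos ⟨by linarith, by linarith⟩ ⟨by linarith, by linarith⟩ he
    linarith
  · have e : V = fun h => ((h * I h) ^ 2 * sin θ₁ * sin θ₂ / 2 + h * I h * h * cos θ₂ * sin θ₁ -
        h ^ 2 * cos θ₁ * cos θ₂ / 2) / sin (θ₁ + θ₂) -
        (h ^ 2 / 2 + (cos (psiRight σ J θ₂) - cos (psiLeft σ J θ₁)) / (g / σ)) * I h +
        (sin (psiRight σ J θ₂) - sin (psiLeft σ J θ₁)) / (g / σ) := rfl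
    rw [e]
    fun_prop
  · have key : ∀ ψ : ℝ, -π < ψ → ψ < 0 → √(1 - cos ψ ^ 2) = -sin ψ := by
      intro ψ ha hb
      rw [← abs_sin_eq_sqrt_one_sub_cos_sq, abs_of_neg (sin_neg_of_neg_of_neg_pi_lt hb ha)]
    rw [key _ hl h₁, key _ hr h₂] at hI0
    have : V 0 = (sin (psiRight σ J θ₂) - sin (psiLeft σ J θ₁) -
        (cos (psiRight σ J θ₂) - cos (psiLeft σ J θ₁)) *
          profileInt (cos (psiLeft σ J θ₁)) (cos (psiRight σ J θ₂)) 0) / (g / σ) := by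
      rw [hV, dropVolume]
      norm_num
      ring
    rw [this, hI0]
    ring
  · intro h hh
    obtain ⟨S, rfl⟩ := hex h hh.1 ((hiff' hh.1.le).1 hh.2)
    exact (hvol S).2
  · set D' := cos (psiRight σ J θ₂) - cos (psiLeft σ J θ₁) with hD'
    have e : V = fun h => I h * (I h * (h ^ 2 * sin θ₁ * sin θ₂ / 2 / sin (θ₁ + θ₂)) +
        (h ^ 2 * (cos θ₂ * sin θ₁ / sin (θ₁ + θ₂)) - (h ^ 2 / 2 + D' / (g / σ)))) +
        ((sin (psiRight σ J θ₂) - sin (psiLeft σ J θ₁)) / (g / σ) -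
          h ^ 2 * cos θ₁ * cos θ₂ / 2 / sin (θ₁ + θ₂)) := by
      ext h
      have e1 : V h = ((h * I h) ^ 2 * sin θ₁ * sin θ₂ / 2 + h * I h * h * cos θ₂ * sin θ₁ -
        h ^ 2 * cos θ₁ * cos θ₂ / 2) / sin (θ₁ + θ₂) - (h ^ 2 / 2 + D' / (g / σ)) * I h +
        (sin (psiRight σ J θ₂) - sin (psiLeft σ J θ₁)) / (g / σ) := rfl
      rw [e1]; ring
    rw [e]
    have hlim : ∀ {f : ℝ → ℝ}, Continuous f → Tendsto f (𝓝[<] hm) (𝓝 (f hm)) :=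
      fun hf => (hf.tendsto hm).mono_left nhdsWithin_le_nhds
    refine Tendsto.atTop_add ?_ (hlim (by fun_prop))
    -- `V` is quadratic in the divergent integral `I`, with leading coefficient proportional to `sin
    -- θ₂`. For `θ₂ = 0` it is linear, and its coefficient tends to `(K - D')/(g/σ)`, positive
    -- because `D' ≤ |D'| < K`.
    rcases hθ₂.eq_or_lt with h0 | h0
    · subst h0
      simp only [sin_zero, mul_zero, zero_div, zero_add, cos_zero, add_zero, one_mul,
        div_self hs1.ne', mul_one]
      refine hIt.atTop_mul_pos ?_ (hlim (by fun_prop))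
      have : hm ^ 2 - (hm ^ 2 / 2 + D' / (g / σ)) = (K - D') / (g / σ) := by
        rw [← hmK]; field_simp; ring
      rw [this]
      exact div_pos (sub_pos.2 ((le_abs_self _).trans_lt habs)) hκ
    · have hs2 : 0 < sin θ₂ := sin_pos_of_pos_of_lt_pi h0 (by linarith)
      refine hIt.atTop_mul_atTop₀ (Tendsto.atTop_add ?_ (hlim (by fun_prop)))
      refine hIt.atTop_mul_pos ?_ (hlim (by fun_prop))
      positivity
  · intro S
    have hd := S.drop_pos hg hσ h₁ h₂
    refine ⟨⟨hd, (hiff' hd.le).2 (hmemS S)⟩, (hvol S).1, hint S, ?_, fun h => ?_⟩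
    · rw [S.boundaryPeak_iff hg hσ h₁ h₂, hint S, not_lt]
    · refine S.exists_stationary hg hσ h₁ h₂ ?_
      by_contra! h'
      exact ((hiff' hd.le).2 h').not_ge h
  · exact fun h hh => hex h hh.1 ((hiff' hh.1.le).1 hh.2)
  · exact fun S T h => S.drop_eq_of_trace_eq hg hσ h₁ h₂ h

end Negative

theorem hasVolumeCurve {g σ J θ₁ θ₂ : ℝ} (hg : 0 < g) (hσ : 0 < σ) (hJ : |J| ≤ σ)
    (hθ₁ : 0 ≤ θ₁) (hθ₂ : 0 ≤ θ₂) (hθ : θ₁ + θ₂ < π)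
    (hsame : 0 < psiLeft σ J θ₁ * psiRight σ J θ₂) : HasVolumeCurve g σ J θ₁ θ₂ := by
  rcases neg_or_swap_neg hsame with h | h
  · exact hasVolumeCurve_of_neg hg hσ h.1 h.2 hθ₁ hθ₂ hθ hJ
  · exact (hasVolumeCurve_of_neg hg hσ h.1 h.2 hθ₂ hθ₁ (by linarith) hJ).mirror

end Capillary

/-! ### Existence and non-uniqueness from the intermediate value theorem. -/

namespace Capillary

theorem exists_eq_of_continuousOn_Ico {V : ℝ → ℝ} {a b c d v : ℝ}
    (hV : ContinuousOn V (Ico c d)) (hc : c ≤ a) (hab : a ≤ b) (hd : b < d)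
    (ha : V a ≤ v) (hb : v ≤ V b) : ∃ h ∈ Icc a b, V h = v :=
  intermediate_value_Icc hab (hV.mono fun _ ht => ⟨hc.trans ht.1, ht.2.trans_lt hd⟩) ⟨ha, hb⟩

theorem HasVolumeCurve.volume_dichotomy {g σ J θ₁ θ₂ : ℝ} (H : HasVolumeCurve g σ J θ₁ θ₂) :
    Vm g σ J θ₁ θ₂ ≤ V1 g σ J θ₁ θ₂ ∧ V1 g σ J θ₁ θ₂ < ⊤ ∧
    (psiLeft σ J θ₁ ≠ psiRight σ J θ₂ → 0 < Vm g σ J θ₁ θ₂) ∧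
    (∀ V : ℝ, 0 < V → ∃ S : FreeSurface g σ J θ₁ θ₂, S.vol = ENNReal.ofReal V) ∧
    (∀ V : ℝ, Vm g σ J θ₁ θ₂ < ENNReal.ofReal V →
      ∃ S : FreeSurface g σ J θ₁ θ₂, S.InteriorPeak ∧ S.vol = ENNReal.ofReal V) ∧
    (∀ V : ℝ, 0 < V → Vm g σ J θ₁ θ₂ = ENNReal.ofReal V →
      ∃ S : FreeSurface g σ J θ₁ θ₂, S.vol = ENNReal.ofReal V ∧
        ∃ s ∈ Icc 0 S.L, IsMinOn (fun t => |S.ψ t|) (Icc 0 S.L) s ∧ g * S.y s = S.P₀) ∧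
    (∀ V : ℝ, 0 < V → ENNReal.ofReal V ≤ V1 g σ J θ₁ θ₂ →
      ∃ S : FreeSurface g σ J θ₁ θ₂, S.BoundaryPeak ∧ S.vol = ENNReal.ofReal V) ∧
    (Vm g σ J θ₁ θ₂ < V1 g σ J θ₁ θ₂ → ∀ V : ℝ, Vm g σ J θ₁ θ₂ ≤ ENNReal.ofReal V →
      ENNReal.ofReal V ≤ V1 g σ J θ₁ θ₂ →
        ∃ S T : FreeSurface g σ J θ₁ θ₂, S.trace ≠ T.trace ∧
          S.vol = ENNReal.ofReal V ∧ T.vol = ENNReal.ofReal V) := by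
  obtain ⟨V, h₀, hₘ, h0, h0m, hψ, hVc, hV0, hVpos, hVlim, hS, hex, htr⟩ := H
  have hm : 0 < hₘ := h0.trans_lt h0m
  have hVnn : ∀ h ∈ Ico 0 hₘ, 0 ≤ V h := by
    intro h hh
    rcases hh.1.eq_or_lt with he | he
    · rw [← he, hV0]
    · exact (hVpos h ⟨he, hh.2⟩).le
  have hlarge : ∀ (v a : ℝ), a < hₘ → ∃ b ∈ Ioo a hₘ, ∀ h ∈ Ico b hₘ, v < V h := by
    intro v a ha
    obtain ⟨c, hc, hcs⟩ := (mem_nhdsLT_iff_exists_Ioo_subset' ha).1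
      (hVlim.eventually (eventually_gt_atTop v))
    have hc1 : c < hₘ := hc
    have hmax : max a c < hₘ := max_lt ha hc1
    obtain ⟨b, hb1, hb2⟩ := exists_between hmax
    exact ⟨b, ⟨(le_max_left _ _).trans_lt hb1, hb2⟩,
      fun h hh => hcs ⟨((le_max_right a c).trans_lt hb1).trans_le hh.1, hh.2⟩⟩
  -- the minimum over the surfaces with an interior extremum
  obtain ⟨m, hmm, hmmin⟩ : ∃ m ∈ Ico h₀ hₘ, ∀ h ∈ Ico h₀ hₘ, V m ≤ V h := by
    obtain ⟨b, hb, hbl⟩ := hlarge (V h₀) h₀ h0m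
    obtain ⟨m, hm1, hm2⟩ := isCompact_Icc.exists_isMinOn (nonempty_Icc.2 hb.1.le)
      (hVc.mono fun t ht => ⟨h0.trans ht.1, ht.2.trans_lt hb.2⟩)
    refine ⟨m, ⟨hm1.1, hm1.2.trans_lt hb.2⟩, fun h hh => ?_⟩
    rcases le_total h b with hle | hle
    · exact hm2 ⟨hh.1, hle⟩
    · exact (hm2 (left_mem_Icc.2 hb.1.le)).trans (hbl h ⟨hle, hh.2⟩).le
  have hVm_le : ∀ h ∈ Ioo h₀ hₘ, Vm g σ J θ₁ θ₂ ≤ ENNReal.ofReal (V h) := by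
    intro h hh
    obtain ⟨S, rfl⟩ := hex h ⟨h0.trans_lt hh.1, hh.2⟩
    rw [← (hS S).2.1]
    exact iInf₂_le S ((hS S).2.2.1.2 hh.1)
  -- A surface with drop `h₀` is of boundary type, so its volume is compared with the infimum by
  -- letting `h` decrease to `h₀`. For the same reason `Vₘ` need not be attained by a surface of
  -- interior type.
  have hVm_le₀ : Vm g σ J θ₁ θ₂ ≤ ENNReal.ofReal (V h₀) := by
    have h1 : Tendsto V (𝓝[>] h₀) (𝓝 (V h₀)) := by
      rw [← nhdsWithin_Ioo_eq_nhdsGT h0m]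
      exact (hVc h₀ ⟨h0, h0m⟩).mono_left (nhdsWithin_mono _ fun t ht => ⟨h0.trans ht.1.le, ht.2⟩)
    exact ge_of_tendsto ((ENNReal.continuous_ofReal.tendsto _).comp h1)
      (eventually_of_mem (Ioo_mem_nhdsGT h0m) hVm_le)
  have hVm : Vm g σ J θ₁ θ₂ = ENNReal.ofReal (V m) := by
    refine le_antisymm ?_ (le_iInf₂ fun S hI => ?_)
    · rcases hmm.1.eq_or_lt with he | he
      · rw [← he]; exact hVm_le₀
      · exact hVm_le m ⟨he, hmm.2⟩
    · rw [(hS S).2.1]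
      exact ENNReal.ofReal_le_ofReal (hmmin _ ⟨((hS S).2.2.1.1 hI).le, (hS S).1.2⟩)
  -- the maximum over the surfaces with an extremum at a contact point
  obtain ⟨M, hM, hMmax⟩ := isCompact_Icc.exists_isMaxOn (nonempty_Icc.2 h0)
    (hVc.mono fun t ht => ⟨ht.1, ht.2.trans_lt h0m⟩)
  have hV1_ge : ∀ h ∈ Icc 0 h₀, ENNReal.ofReal (V h) ≤ V1 g σ J θ₁ θ₂ := by
    intro h hh
    rcases hh.1.eq_or_lt with he | he
    · rw [← he, hV0]; simp
    · obtain ⟨S, rfl⟩ := hex h ⟨he, hh.2.trans_lt h0m⟩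
      rw [← (hS S).2.1]
      exact le_iSup₂ (f := fun (S : FreeSurface g σ J θ₁ θ₂) (_ : S.BoundaryPeak) => S.vol) S
        ((hS S).2.2.2.1.2 hh.2)
  have hV1 : V1 g σ J θ₁ θ₂ = ENNReal.ofReal (V M) := by
    refine le_antisymm (iSup₂_le fun S hB => ?_) (hV1_ge M hM)
    rw [(hS S).2.1]
    exact ENNReal.ofReal_le_ofReal (hMmax ⟨(hS S).1.1.le, (hS S).2.2.2.1.1 hB⟩)
  have hboundary : ∀ v : ℝ, 0 < v → v ≤ V M → ∃ h ∈ Ioc 0 M, V h = v := by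
    intro v hv hvM
    obtain ⟨h, hh, he⟩ := exists_eq_of_continuousOn_Ico hVc le_rfl hM.1 (hM.2.trans_lt h0m)
      (by rw [hV0]; exact hv.le) hvM
    refine ⟨h, ⟨lt_of_le_of_ne hh.1 ?_, hh.2⟩, he⟩
    rintro rfl
    rw [hV0] at he
    exact hv.ne he
  have habove : ∀ v a : ℝ, a ∈ Ico 0 hₘ → V a ≤ v → ∃ h ∈ Ico a hₘ, V h = v := by
    intro v a ha hav
    obtain ⟨b, hb, hbl⟩ := hlarge v a ha.2
    obtain ⟨h, hh, he⟩ := exists_eq_of_continuousOn_Ico hVc ha.1 hb.1.le hb.2 hav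
      (hbl b ⟨le_rfl, hb.2⟩).le
    exact ⟨h, ⟨hh.1, hh.2.trans_lt hb.2⟩, he⟩
  have hm0 : m ∈ Ico 0 hₘ := ⟨h0.trans hmm.1, hmm.2⟩
  refine ⟨hVm_le₀.trans (hV1_ge h₀ ⟨h0, le_rfl⟩), ?_, ?_, ?_, ?_, ?_, ?_, ?_⟩
  · rw [hV1]; exact ENNReal.ofReal_lt_top
  · intro hne
    have : 0 < h₀ := lt_of_le_of_ne h0 fun he => hne (hψ he.symm)
    rw [hVm, ENNReal.ofReal_pos]
    exact hVpos m ⟨this.trans_le hmm.1, hmm.2⟩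
  · intro v hv
    obtain ⟨h, hh, rfl⟩ := habove v 0 ⟨le_rfl, hm⟩ (by rw [hV0]; exact hv.le)
    obtain ⟨S, rfl⟩ := hex h ⟨lt_of_le_of_ne hh.1 (by rintro rfl; rw [hV0] at hv; exact hv.false),
      hh.2⟩
    exact ⟨S, (hS S).2.1⟩
  · intro v hv
    rw [hVm, ENNReal.ofReal_lt_ofReal_iff'] at hv
    obtain ⟨h, hh, rfl⟩ := habove v m hm0 hv.1.le
    have hlt : m < h := lt_of_le_of_ne hh.1 (by rintro rfl; exact hv.1.false)
    obtain ⟨S, rfl⟩ := hex h ⟨hm0.1.trans_lt hlt, hh.2⟩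
    exact ⟨S, (hS S).2.2.1.2 (hmm.1.trans_lt hlt), (hS S).2.1⟩
  · intro v hv he
    rw [hVm, ENNReal.ofReal_eq_ofReal_iff (hVnn m hm0) hv.le] at he
    subst he
    have hpos : 0 < m := lt_of_le_of_ne hm0.1 (by rintro rfl; rw [hV0] at hv; exact hv.false)
    obtain ⟨S, hSm⟩ := hex m ⟨hpos, hmm.2⟩
    refine ⟨S, ?_, (hS S).2.2.2.2 ?_⟩
    · rw [(hS S).2.1, hSm]
    · rw [hSm]; exact hmm.1
  · intro v hv hle
    rw [hV1, ENNReal.ofReal_le_ofReal_iff (hVnn M ⟨hM.1, hM.2.trans_lt h0m⟩)] at hle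
    obtain ⟨h, hh, rfl⟩ := hboundary v hv hle
    obtain ⟨S, rfl⟩ := hex h ⟨hh.1, (hh.2.trans hM.2).trans_lt h0m⟩
    exact ⟨S, (hS S).2.2.2.1.2 (hh.2.trans hM.2), (hS S).2.1⟩
  · intro hlt v hv1 hv2
    rw [hVm, hV1, ENNReal.ofReal_lt_ofReal_iff'] at hlt
    have hMpos : 0 < M := lt_of_le_of_ne hM.1 (by
      rintro rfl; rw [hV0] at hlt; exact hlt.2.false)
    have hVm0 := hVpos m ⟨(hMpos.trans_le hM.2).trans_le hmm.1, hmm.2⟩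
    have hvm : V m ≤ v := by
      rw [hVm, ENNReal.ofReal_le_ofReal_iff'] at hv1
      exact hv1.resolve_right (not_le.2 hVm0)
    have hvM : v ≤ V M := by
      rwa [hV1, ENNReal.ofReal_le_ofReal_iff hlt.2.le] at hv2
    -- One drop is taken in `(0, M]` and one in `[m, hₘ)`, with `M ≤ h₀ ≤ m`. They can coincide only
    -- if `M = h₀ = m`, which contradicts `V m < V M`.
    obtain ⟨a, ha, hae⟩ := hboundary v (hVm0.trans_le hvm) hvM
    obtain ⟨b, hb, hbe⟩ := habove v m hm0 hvm
    obtain ⟨S, hSa⟩ := hex a ⟨ha.1, (ha.2.trans hM.2).trans_lt h0m⟩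
    obtain ⟨T, hTb⟩ := hex b ⟨(ha.1.trans_le (ha.2.trans hM.2)).trans_le (hmm.1.trans hb.1), hb.2⟩
    refine ⟨S, T, fun h => ?_, by rw [(hS S).2.1, hSa, hae], by rw [(hS T).2.1, hTb, hbe]⟩
    have hab : a = b := by rw [← hSa, ← hTb]; exact htr S T h
    have hMm : M = m := le_antisymm (hM.2.trans hmm.1) (by
      rw [hab] at ha; exact hb.1.trans ha.2)
    rw [hMm] at hlt
    exact hlt.1.false

end Capillary

theorem theorem1p4 (g σ J θ₁ θ₂ : ℝ) (hg : 0 < g) (hσ : 0 < σ) (hJ : |J| ≤ σ)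
    (hθ₁ : 0 ≤ θ₁) (hθ₂ : 0 ≤ θ₂) (hθ : θ₁ + θ₂ < π)
    (hsame : 0 < Capillary.psiLeft σ J θ₁ * Capillary.psiRight σ J θ₂) :
    -- the comparison of the two threshold volumes, which are finite, and positive if `ψ₁ ≠ ψ₂`
    Capillary.Vm g σ J θ₁ θ₂ ≤ Capillary.V1 g σ J θ₁ θ₂ ∧
    Capillary.V1 g σ J θ₁ θ₂ < ⊤ ∧
    (Capillary.psiLeft σ J θ₁ ≠ Capillary.psiRight σ J θ₂ → 0 < Capillary.Vm g σ J θ₁ θ₂) ∧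
    -- existence for every volume
    (∀ V : ℝ, 0 < V → ∃ S : Capillary.FreeSurface g σ J θ₁ θ₂, S.vol = ENNReal.ofReal V) ∧
    -- the two kinds of solutions
    (∀ V : ℝ, Capillary.Vm g σ J θ₁ θ₂ < ENNReal.ofReal V →
      ∃ S : Capillary.FreeSurface g σ J θ₁ θ₂, S.InteriorPeak ∧ S.vol = ENNReal.ofReal V) ∧
    (∀ V : ℝ, 0 < V → Capillary.Vm g σ J θ₁ θ₂ = ENNReal.ofReal V →
      ∃ S : Capillary.FreeSurface g σ J θ₁ θ₂, S.vol = ENNReal.ofReal V ∧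
        ∃ s ∈ Icc 0 S.L, IsMinOn (fun t => |S.ψ t|) (Icc 0 S.L) s ∧ g * S.y s = S.P₀) ∧
    (∀ V : ℝ, 0 < V → ENNReal.ofReal V ≤ Capillary.V1 g σ J θ₁ θ₂ →
      ∃ S : Capillary.FreeSurface g σ J θ₁ θ₂, S.BoundaryPeak ∧ S.vol = ENNReal.ofReal V) ∧
    -- non-uniqueness
    (Capillary.Vm g σ J θ₁ θ₂ < Capillary.V1 g σ J θ₁ θ₂ →
      ∀ V : ℝ, Capillary.Vm g σ J θ₁ θ₂ ≤ ENNReal.ofReal V →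
        ENNReal.ofReal V ≤ Capillary.V1 g σ J θ₁ θ₂ →
        ∃ S T : Capillary.FreeSurface g σ J θ₁ θ₂, S.trace ≠ T.trace ∧
          S.vol = ENNReal.ofReal V ∧ T.vol = ENNReal.ofReal V) ∧
    -- every solution is a polar graph that solves the polar system, with the same volume
    (∀ S : Capillary.FreeSurface g σ J θ₁ θ₂, ∃ ρ : ℝ → ℝ,
      Capillary.PolarSystem g σ J θ₁ θ₂ S.P₀ ρ ∧
      S.trace = (fun θ => (ρ θ * cos θ, ρ θ * sin θ)) '' Capillary.angles θ₁ θ₂ ∧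
      S.vol = ENNReal.ofReal (Capillary.polarVolume θ₁ θ₂ ρ)) ∧
    -- and, unless a prescribed angle is beyond the vertical, a graph over the `x`-axis that
    -- solves the Cartesian system
    (|Capillary.psiLeft σ J θ₁| ≤ π / 2 → |Capillary.psiRight σ J θ₂| ≤ π / 2 →
      ∀ S : Capillary.FreeSurface g σ J θ₁ θ₂, ∃ v : ℝ → ℝ,
        Capillary.CartesianSystem g σ (Capillary.psiLeft σ J θ₁) (Capillary.psiRight σ J θ₂) S.P₀
          (S.x 0) (S.x S.L) v ∧
        S.trace = (fun x => (x, v x)) '' Icc (S.x 0) (S.x S.L)) := by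
  obtain ⟨c1, c2, c3, c4, c5, c6, c7, c8⟩ :=
    (Capillary.hasVolumeCurve hg hσ hJ hθ₁ hθ₂ hθ hsame).volume_dichotomy
  refine ⟨c1, c2, c3, c4, c5, c6, c7, c8, fun S => ?_, fun hl hr S => ?_⟩
  · obtain ⟨ρ, h1, h2, h3, -⟩ := S.exists_polar_graph
      (fun s hs => S.support_pos hg hσ hθ₁ hθ₂ hθ hsame hs)
      (fun s hs => S.y_nonneg hg hσ hθ₁ hθ₂ hθ hsame hs) hθ₁ hθ₂ hθ hσ hJ
    exact ⟨ρ, h1, h2, h3⟩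
  -- Inside the curve `|ψ|` lies strictly below its larger end value, so vertical contacts are
  -- allowed.
  · refine S.exists_cartesian_graph hσ fun s hs => ?_
    refine (S.abs_ψ_lt hg hσ hsame hs).trans_le (max_le ?_ ?_)
    · rw [S.left_angle]; exact hl
    · rw [S.right_angle]; exact hr
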